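/- **Conventions.** Let $F$ be a field of characteristic $0$. A pro-algebraic group over $F$ is an affine group scheme $Q=\operatorname{Spec} H$ over $F$ ($H$ a commutative Hopf algebra); for a commutative $F$-algebra $\Lambda$, $Q(\Lambda)=\operatorname{Hom}_{F\text{-alg}}(H,\Lambda)$. For an $F$-linear category $\mathcal{C}$, let $\mathcal{C}_\Lambda$ be the category with the same objects (written $C\otimes\Lambda$) and $\operatorname{Hom}_{\mathcal{C}_\Lambda}(C_1\otimes\Lambda,C_2\otimes\Lambda)=\operatorname{Hom}_{\mathcal{C}}(C_1,C_2)\otimes_F\Lambda$; an $F$-algebra map $\phi\colon\Lambda\to\Lambda'$ induces a transition functor $-\otimes_{\Lambda,\phi}\Lambda'\colon\mathcal{C}_\Lambda\to\mathcal{C}_{\Lambda'}$. If $\mathcal{C}$ is symmetric monoidal with $F$-bilinear tensor product, $\mathcal{C}_\Lambda$ is symmetric monoidal with $(C_1\otimes\Lambda)\otimes(C_2\otimes\Lambda)=(C_1\otimes C_2)\otimes\Lambda$. "Monoidal" always means unitary symmetric monoidal. An *action* of an abstract group $G$ on a category $\mathcal{D}$ consists of functors $g\cdot-\colon\mathcal{D}\to\mathcal{D}$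 ($g\in G$) and natural isomorphisms $1\cdot-\cong\mathrm{id}$ and $g_2\cdot(g_1\cdot-)\cong(g_2g_1)\cdot-$ satisfying the usual unit and associativity coherence conditions; it is *monoidal* if the functors are (strong, symmetric) monoidal and the natural isomorphisms are monoidal. An *equivariant object* is an object $D$ with isomorphisms $\alpha_g\colon g\cdot D\xrightarrow{\sim}D$ such that $\alpha_1$ is the given isomorphism $1\cdot D\cong D$ and $\alpha_{g_2g_1}=\alpha_{g_2}\circ(g_2\cdot\alpha_{g_1})$ under the identification $g_2\cdot(g_1\cdot D)\cong(g_2g_1)\cdot D$. An *$F$-algebraic action* of $Q$ on $\mathcal{C}$ is, for every commutative $F$-algebra $\Lambda$, a $\Lambda$-linear action of the group $Q(\Lambda)$ on $\mathcal{C}_\Lambda$, functorially in $\Lambda$: for every $\phi\colon\Lambda\to\Lambda'$ and $q\in Q(\Lambda)$ one has an identification $(q\cdot-)\otimes_{\Lambda,\phi}\Lambda'\cong\phi(q)\cdot(-\otimes_{\Lambda,\phi}\Lambda')$ of functors $\mathcal{C}_\Lambda\to\mathcal{C}_{\Lambda'}$ (an equality, or more generally a given natural isomorphism), compatible with composition of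 algebra maps and with the structural isomorphisms of the actions. It is *monoidal* if all the actions of the $Q(\Lambda)$, and these identifications, are monoidal. The category $\mathcal{C}^Q$ of *$F$-algebraic equivariant objects* has as objects the pairs $(C,\underline{\alpha})$ with $C\in\mathcal{C}$ and $\underline\alpha=(\alpha_{\Lambda,q})$ such that, for every $\Lambda$, $(\alpha_{\Lambda,q})_{q\in Q(\Lambda)}$ makes $C\otimes\Lambda$ an equivariant object of $\mathcal{C}_\Lambda$, and such that every $\phi\colon\Lambda\to\Lambda'$ carries $\alpha_{\Lambda,q}$ to $\alpha_{\Lambda',\phi(q)}$; its morphisms are the morphisms $f$ of $\mathcal{C}$ that are compatible with the $\alpha_{\Lambda,q}$ for all $\Lambda$ and $q\in Q(\Lambda)$. If the action is monoidal, $\mathcal{C}^Q$ is $F$-linear symmetric monoidal with $(C_1,\underline\alpha_1)\otimes(C_2,\underline\alpha_2)=(C_1\otimes C_2,\underline\alpha_1\otimes\underline\alpha_2)$, and the forgetful functor $\mathrm{for}_Q\colon\mathcal{C}^Q\to\mathcal{C}$ is $F$-linear and monoidal. A *neutral Tannakian category* over $F$ is an abelian $F$-linear rigid symmetric monoidal category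 with $F$-bilinear tensor product and $\operatorname{End}(\mathbf 1)=F$, for which there exists a *fibre functor*, i.e. an exact faithful $F$-linear symmetric monoidal functor to the category of finite-dimensional $F$-vector spaces. **Proposition.** Let $\mathcal{T}$ be a neutral Tannakian category over $F$, and let $Q$ be a pro-algebraic group over $F$ with a monoidal $F$-algebraic action on $\mathcal{T}$. Then the symmetric monoidal $F$-linear category $\mathcal{T}^Q$ is neutral Tannakian over $F$ (in particular abelian and rigid). Moreover: 1. for every $(V,\underline\alpha)\in\mathcal{T}^Q$ and every dual $V^\vee$ of $V$ in $\mathcal{T}$ (with given evaluation and coevaluation), there is a structure $\underline\alpha^\vee$ of $F$-algebraic equivariant object on $V^\vee$ such that, for all $\Lambda$ and $q\in Q(\Lambda)$, the map $\alpha^\vee_{\Lambda,q}\colon q\cdot(V^\vee\otimes\Lambda)=(q\cdot(V\otimes\Lambda))^\vee\xrightarrow{\sim}(V\otimes\Lambda)^\vee=V^\vee\otimes\Lambda$ is the inverse-transpose of $\alpha_{\Lambda,q}$, and $(V^\vee,\underline\alpha^\vee)$ is a dual of $(V,\underline\alpha)$ in $\mathcal{T}^Q$ with the same evaluation and coevaluation;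 2. for every fibre functor $\omega$ of $\mathcal{T}$, the composite $\omega\circ\mathrm{for}_Q$ is a fibre functor of $\mathcal{T}^Q$. -/

import Mathlib

open CategoryTheory MonoidalCategory
open scoped TensorProduct

universe u v w

/-! ## Extension of scalars of an `F`-linear category -/

/-- The objects of the category `C_Λ`: the same as those of `C`. For `X : C`, the object
`⟨X⟩ : BaseChange F C Λ` is the one usually written `X ⊗ Λ`. -/
@[ext]
structure BaseChange (F : Type u) (C : Type w) (Λ : Type u) where
  /-- the underlying object of `C` -/
  obj : C

namespace BaseChange

variable {F : Type u} [Field F] {C : Type w} [Category.{v} C] [Preadditive C] [Linear F C]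
variable {Λ : Type u} [CommRing Λ] [Algebra F Λ]

/-- `Hom_{C_Λ}(X ⊗ Λ, Y ⊗ Λ) = Λ ⊗ Hom_C(X, Y)`; composition and identities are the `Λ`-bilinear
extensions of those of `C`. -/
noncomputable instance : Category (BaseChange F C Λ) where
  Hom X Y := Λ ⊗[F] (X.obj ⟶ Y.obj)
  id X := (1 : Λ) ⊗ₜ[F] 𝟙 X.obj
  comp {X Y Z} f g :=
    TensorProduct.map₂ (LinearMap.mul F Λ) (Linear.comp (S := F) X.obj Y.obj Z.obj) f g
  id_comp {X Y} f := by
    induction f using TensorProduct.induction_on with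
    | zero => simp
    | tmul a f => simp
    | add f g hf hg => rw [map_add, hf, hg]
  comp_id {X Y} f := by
    induction f using TensorProduct.induction_on with
    | zero => simp
    | tmul a f => simp
    | add f g hf hg => rw [map_add, LinearMap.add_apply, hf, hg]
  assoc {W X Y Z} f g h := by
    induction f using TensorProduct.induction_on with
    | zero => simp
    | add f₁ f₂ h₁ h₂ => simp only [map_add, LinearMap.add_apply, h₁, h₂]
    | tmul a f =>
      induction g using TensorProduct.induction_on with
      | zero => simp
      | add f₁ f₂ h₁ h₂ => simp only [map_add, LinearMap.add_apply, h₁, h₂]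
      | tmul b g =>
        induction h using TensorProduct.induction_on with
        | zero => simp
        | add f₁ f₂ h₁ h₂ => simp only [map_add, h₁, h₂]
        | tmul c h => simp [mul_assoc]

/-- The morphism `a ⊗ f` of `C_Λ`. -/
noncomputable def tm {X Y : BaseChange F C Λ} (a : Λ) (f : X.obj ⟶ Y.obj) : X ⟶ Y :=
  a ⊗ₜ[F] f

noncomputable instance : Preadditive (BaseChange F C Λ) where
  homGroup X Y := inferInstanceAs (AddCommGroup (Λ ⊗[F] (X.obj ⟶ Y.obj)))
  add_comp X Y Z f f' g := LinearMap.map_add₂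
    (TensorProduct.map₂ (LinearMap.mul F Λ) (Linear.comp (S := F) X.obj Y.obj Z.obj)) f f' g
  comp_add X Y Z f g g' := LinearMap.map_add
    (TensorProduct.map₂ (LinearMap.mul F Λ) (Linear.comp (S := F) X.obj Y.obj Z.obj) f) g g'

/-- Every morphism of `C_Λ` is a sum of morphisms `a ⊗ f`. -/
theorem hom_induction {X Y : BaseChange F C Λ} {motive : (X ⟶ Y) → Prop} (f : X ⟶ Y)
    (zero : motive 0) (tm : ∀ a f, motive (tm a f))
    (add : ∀ f g, motive f → motive g → motive (f + g)) : motive f :=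
  TensorProduct.induction_on (motive := motive) f zero tm add

theorem id_eq_tm (X : BaseChange F C Λ) : 𝟙 X = tm 1 (𝟙 X.obj) := rfl

@[simp]
theorem tm_comp_tm {X Y Z : BaseChange F C Λ} (a b : Λ) (f : X.obj ⟶ Y.obj) (g : Y.obj ⟶ Z.obj) :
    tm a f ≫ tm b g = tm (X := X) (Y := Z) (a * b) (f ≫ g) :=
  rfl

noncomputable instance (X Y : BaseChange F C Λ) : Module Λ (X ⟶ Y) :=
  inferInstanceAs (Module Λ (Λ ⊗[F] (X.obj ⟶ Y.obj)))

noncomputable instance : Linear Λ (BaseChange F C Λ) where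
  smul_comp X Y Z r f g := by
    induction f using hom_induction with
    | zero => rw [smul_zero, Limits.zero_comp, smul_zero]
    | add f₁ f₂ h₁ h₂ => rw [smul_add, Preadditive.add_comp, Preadditive.add_comp, smul_add, h₁, h₂]
    | tm a f =>
      induction g using hom_induction with
      | zero => rw [Limits.comp_zero, Limits.comp_zero, smul_zero]
      | add f₁ f₂ h₁ h₂ => rw [Preadditive.comp_add, Preadditive.comp_add, smul_add, h₁, h₂]
      | tm b g =>
        change tm (r * a) f ≫ tm b g = _
        rw [tm_comp_tm, tm_comp_tm, mul_assoc]
        rfl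
  comp_smul X Y Z f r g := by
    induction f using hom_induction with
    | zero => rw [Limits.zero_comp, Limits.zero_comp, smul_zero]
    | add f₁ f₂ h₁ h₂ => rw [Preadditive.add_comp, Preadditive.add_comp, smul_add, h₁, h₂]
    | tm a f =>
      induction g using hom_induction with
      | zero => rw [smul_zero, Limits.comp_zero, smul_zero]
      | add f₁ f₂ h₁ h₂ => rw [smul_add, Preadditive.comp_add, Preadditive.comp_add, smul_add, h₁, h₂]
      | tm b g =>
        change tm a f ≫ tm (r * b) g = _
        rw [tm_comp_tm, tm_comp_tm, mul_left_comm]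
        rfl

theorem tm_zero {X Y : BaseChange F C Λ} (a : Λ) : tm a (0 : X.obj ⟶ Y.obj) = 0 :=
  TensorProduct.tmul_zero _ a

theorem tm_add {X Y : BaseChange F C Λ} (a : Λ) (f g : X.obj ⟶ Y.obj) :
    tm (X := X) (Y := Y) a (f + g) = tm a f + tm a g :=
  TensorProduct.tmul_add a f g

theorem tm_smul {X Y : BaseChange F C Λ} (a : Λ) (r : F) (f : X.obj ⟶ Y.obj) :
    tm (X := X) (Y := Y) a (r • f) = algebraMap F Λ r • tm (X := X) (Y := Y) a f := by
  change a ⊗ₜ[F] (r • f) = (algebraMap F Λ r * a) ⊗ₜ[F] f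
  rw [TensorProduct.tmul_smul, ← Algebra.smul_def, TensorProduct.smul_tmul']

variable (F C Λ) in
/-- The functor `C ⥤ C_Λ`, `X ↦ X ⊗ Λ`, `f ↦ 1 ⊗ f`. -/
@[simps obj]
noncomputable def incl : C ⥤ BaseChange F C Λ where
  obj X := ⟨X⟩
  map f := tm 1 f
  map_id _ := rfl
  map_comp f g := by simp

theorem incl_map {X Y : C} (f : X ⟶ Y) :
    (incl F C Λ).map f = tm (X := ⟨X⟩) (Y := ⟨Y⟩) 1 f := rfl

section Map

variable {Λ' : Type u} [CommRing Λ'] [Algebra F Λ'] {Λ'' : Type u} [CommRing Λ''] [Algebra F Λ'']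

/-- The transition functor `C_Λ ⥤ C_Λ'` of an `F`-algebra homomorphism `φ : Λ → Λ'`:
`X ⊗ Λ ↦ X ⊗ Λ'` and `a ⊗ f ↦ φ a ⊗ f`. -/
@[simps obj]
noncomputable def map (φ : Λ →ₐ[F] Λ') : BaseChange F C Λ ⥤ BaseChange F C Λ' where
  obj X := ⟨X.obj⟩
  map {X Y} f := LinearMap.rTensor (X.obj ⟶ Y.obj) φ.toLinearMap f
  map_id X := by
    change φ 1 ⊗ₜ[F] 𝟙 X.obj = _
    rw [map_one]; rfl
  map_comp {X Y Z} f g := by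
    induction f using hom_induction with
    | zero =>
      rw [Limits.zero_comp, map_zero, map_zero]
      exact (LinearMap.map_zero₂ (TensorProduct.map₂ (LinearMap.mul F Λ')
        (Linear.comp (S := F) X.obj Y.obj Z.obj)) _).symm
    | add f₁ f₂ h₁ h₂ =>
      rw [Preadditive.add_comp, map_add, map_add, h₁, h₂]
      exact (Preadditive.add_comp _ _ _ _ _ _).symm
    | tm a f =>
      induction g using hom_induction with
      | zero =>
        rw [Limits.comp_zero, map_zero, map_zero]
        exact (LinearMap.map_zero (TensorProduct.map₂ (LinearMap.mul F Λ')
          (Linear.comp (S := F) X.obj Y.obj Z.obj) _)).symm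
      | add f₁ f₂ h₁ h₂ =>
        rw [Preadditive.comp_add, map_add, map_add, h₁, h₂]
        exact (Preadditive.comp_add _ _ _ _ _ _).symm
      | tm b g =>
        rw [tm_comp_tm]
        change φ (a * b) ⊗ₜ[F] (f ≫ g) = _
        rw [map_mul]
        exact (tm_comp_tm (X := ⟨X.obj⟩) (Y := ⟨Y.obj⟩) (Z := ⟨Z.obj⟩) (φ a) (φ b) f g).symm

@[simp]
theorem map_tm (φ : Λ →ₐ[F] Λ') {X Y : BaseChange F C Λ} (a : Λ) (f : X.obj ⟶ Y.obj) :
    (map φ).map (tm a f) = tm (X := ⟨X.obj⟩) (Y := ⟨Y.obj⟩) (φ a) f := rfl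

instance (φ : Λ →ₐ[F] Λ') : (map (C := C) φ).Additive where
  map_add {X Y f g} := _root_.map_add (LinearMap.rTensor (X.obj ⟶ Y.obj) φ.toLinearMap) f g

end Map

section Monoidal

variable [MonoidalCategory C] [MonoidalPreadditive C] [MonoidalLinear F C]

/-- `g ↦ X ◁ g`, as an `F`-linear map. -/
def whiskerLeftₗ (X Y Z : C) : (Y ⟶ Z) →ₗ[F] (X ⊗ Y ⟶ X ⊗ Z) where
  toFun g := X ◁ g
  map_add' := by simp
  map_smul' := by simp

/-- `g ↦ g ▷ X`, as an `F`-linear map. -/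
def whiskerRightₗ (X Y Z : C) : (Y ⟶ Z) →ₗ[F] (Y ⊗ X ⟶ Z ⊗ X) where
  toFun g := g ▷ X
  map_add' := by simp
  map_smul' := by simp

/-- The tensor product of `C_Λ` is that of `C` on objects and its `Λ`-bilinear extension on
morphisms; unit, associator and unitors are those of `C`. -/
noncomputable instance : MonoidalCategoryStruct (BaseChange F C Λ) where
  tensorObj X Y := ⟨X.obj ⊗ Y.obj⟩
  tensorUnit := ⟨𝟙_ C⟩
  whiskerLeft X Y Z g := LinearMap.lTensor Λ (whiskerLeftₗ (F := F) X.obj Y.obj Z.obj) g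
  whiskerRight {Y Z} g X := LinearMap.lTensor Λ (whiskerRightₗ (F := F) X.obj Y.obj Z.obj) g
  associator X Y Z := (incl F C Λ).mapIso (α_ X.obj Y.obj Z.obj)
  leftUnitor X := (incl F C Λ).mapIso (λ_ X.obj)
  rightUnitor X := (incl F C Λ).mapIso (ρ_ X.obj)

@[simp] theorem tensorObj_obj (X Y : BaseChange F C Λ) : (X ⊗ Y).obj = X.obj ⊗ Y.obj := rfl

@[simp] theorem tensorUnit_obj : (𝟙_ (BaseChange F C Λ)).obj = 𝟙_ C := rfl

@[simp]
theorem whiskerLeft_tm (X : BaseChange F C Λ) {Y Z : BaseChange F C Λ} (a : Λ)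
    (f : Y.obj ⟶ Z.obj) : X ◁ tm a f = tm (X := X ⊗ Y) (Y := X ⊗ Z) a (X.obj ◁ f) := rfl

@[simp]
theorem tm_whiskerRight (X : BaseChange F C Λ) {Y Z : BaseChange F C Λ} (a : Λ)
    (f : Y.obj ⟶ Z.obj) : tm a f ▷ X = tm (X := Y ⊗ X) (Y := Z ⊗ X) a (f ▷ X.obj) := rfl

@[simp]
theorem tm_tensor_tm {X₁ Y₁ X₂ Y₂ : BaseChange F C Λ} (a b : Λ) (f : X₁.obj ⟶ Y₁.obj)
    (g : X₂.obj ⟶ Y₂.obj) :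
    tm a f ⊗ₘ tm b g = tm (X := X₁ ⊗ X₂) (Y := Y₁ ⊗ Y₂) (a * b) (f ⊗ₘ g) := by
  change tm a f ▷ X₂ ≫ Y₁ ◁ tm b g = _
  simp [MonoidalCategory.tensorHom_def]

theorem whiskerLeft_zero' (X Y Z : BaseChange F C Λ) : X ◁ (0 : Y ⟶ Z) = 0 :=
  map_zero (LinearMap.lTensor Λ (whiskerLeftₗ (F := F) X.obj Y.obj Z.obj))

theorem whiskerLeft_add' (X : BaseChange F C Λ) {Y Z : BaseChange F C Λ} (f g : Y ⟶ Z) :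
    X ◁ (f + g) = X ◁ f + X ◁ g :=
  map_add (LinearMap.lTensor Λ (whiskerLeftₗ (F := F) X.obj Y.obj Z.obj)) f g

theorem zero_whiskerRight' (X Y Z : BaseChange F C Λ) : (0 : Y ⟶ Z) ▷ X = 0 :=
  map_zero (LinearMap.lTensor Λ (whiskerRightₗ (F := F) X.obj Y.obj Z.obj))

theorem add_whiskerRight' (X : BaseChange F C Λ) {Y Z : BaseChange F C Λ} (f g : Y ⟶ Z) :
    (f + g) ▷ X = f ▷ X + g ▷ X :=
  map_add (LinearMap.lTensor Λ (whiskerRightₗ (F := F) X.obj Y.obj Z.obj)) f g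

theorem associator_hom (X Y Z : BaseChange F C Λ) :
    (α_ X Y Z).hom = tm (X := (X ⊗ Y) ⊗ Z) (Y := X ⊗ Y ⊗ Z) 1 (α_ X.obj Y.obj Z.obj).hom := rfl

theorem leftUnitor_hom (X : BaseChange F C Λ) :
    (λ_ X).hom = tm (X := 𝟙_ _ ⊗ X) (Y := X) 1 (λ_ X.obj).hom := rfl

theorem rightUnitor_hom (X : BaseChange F C Λ) :
    (ρ_ X).hom = tm (X := X ⊗ 𝟙_ _) (Y := X) 1 (ρ_ X.obj).hom := rfl

theorem tensorHom_def' {X₁ Y₁ X₂ Y₂ : BaseChange F C Λ} (f : X₁ ⟶ Y₁) (g : X₂ ⟶ Y₂) :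
    f ⊗ₘ g = f ▷ X₂ ≫ Y₁ ◁ g := rfl

theorem whiskerLeft_comp' (X : BaseChange F C Λ) {Y Z W : BaseChange F C Λ} (f : Y ⟶ Z)
    (g : Z ⟶ W) : X ◁ (f ≫ g) = X ◁ f ≫ X ◁ g := by
  induction f using hom_induction with
  | zero => simp only [Limits.zero_comp, whiskerLeft_zero']
  | add f₁ f₂ h₁ h₂ => simp only [Preadditive.add_comp, whiskerLeft_add', h₁, h₂]
  | tm a f =>
    induction g using hom_induction with
    | zero => simp only [Limits.comp_zero, whiskerLeft_zero']
    | add f₁ f₂ h₁ h₂ => simp only [Preadditive.comp_add, whiskerLeft_add', h₁, h₂]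
    | tm b g => simp

theorem comp_whiskerRight' {Y Z W : BaseChange F C Λ} (f : Y ⟶ Z)
    (g : Z ⟶ W) (X : BaseChange F C Λ) : (f ≫ g) ▷ X = f ▷ X ≫ g ▷ X := by
  induction f using hom_induction with
  | zero => simp only [Limits.zero_comp, zero_whiskerRight']
  | add f₁ f₂ h₁ h₂ => simp only [Preadditive.add_comp, add_whiskerRight', h₁, h₂]
  | tm a f =>
    induction g using hom_induction with
    | zero => simp only [Limits.comp_zero, zero_whiskerRight']
    | add f₁ f₂ h₁ h₂ => simp only [Preadditive.comp_add, add_whiskerRight', h₁, h₂]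
    | tm b g => simp

theorem whisker_exchange' {W X Y Z : BaseChange F C Λ} (f : W ⟶ X) (g : Y ⟶ Z) :
    W ◁ g ≫ f ▷ Z = f ▷ Y ≫ X ◁ g := by
  induction f using hom_induction with
  | zero => simp only [zero_whiskerRight', Limits.zero_comp, Limits.comp_zero]
  | add f₁ f₂ h₁ h₂ =>
    simp only [add_whiskerRight', Preadditive.add_comp, Preadditive.comp_add, h₁, h₂]
  | tm a f =>
    induction g using hom_induction with
    | zero => simp only [whiskerLeft_zero', Limits.zero_comp, Limits.comp_zero]
    | add f₁ f₂ h₁ h₂ =>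
      simp only [whiskerLeft_add', Preadditive.add_comp, Preadditive.comp_add, h₁, h₂]
    | tm b g => simp [mul_comm, whisker_exchange]

noncomputable instance : MonoidalCategory (BaseChange F C Λ) where
  tensorHom_def := tensorHom_def'
  id_tensorHom_id X Y := by
    rw [id_eq_tm, id_eq_tm, tm_tensor_tm]
    simp only [mul_one, id_tensorHom_id]; rfl
  tensorHom_comp_tensorHom f₁ f₂ g₁ g₂ := by
    simp only [tensorHom_def', whiskerLeft_comp', comp_whiskerRight', Category.assoc]
    rw [← Category.assoc (_ ◁ f₂), whisker_exchange', Category.assoc]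
  whiskerLeft_id X Y := by
    rw [id_eq_tm, whiskerLeft_tm]
    simp only [whiskerLeft_id]; rfl
  id_whiskerRight X Y := by
    rw [id_eq_tm, tm_whiskerRight]
    simp only [id_whiskerRight]; rfl
  associator_naturality f₁ f₂ f₃ := by
    induction f₁ using hom_induction with
    | zero =>
      simp only [tensorHom_def', zero_whiskerRight', Limits.zero_comp, Limits.comp_zero]
    | add f g h₁ h₂ =>
      simp only [tensorHom_def', add_whiskerRight', Preadditive.add_comp,
        Preadditive.comp_add] at h₁ h₂ ⊢
      rw [h₁, h₂]
    | tm a f₁ =>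
      induction f₂ using hom_induction with
      | zero =>
        simp only [tensorHom_def', zero_whiskerRight', whiskerLeft_zero', Limits.zero_comp,
          Limits.comp_zero]
      | add f g h₁ h₂ =>
        simp only [tensorHom_def', add_whiskerRight', whiskerLeft_add', Preadditive.add_comp,
          Preadditive.comp_add] at h₁ h₂ ⊢
        rw [h₁, h₂]
      | tm b f₂ =>
        induction f₃ using hom_induction with
        | zero =>
          simp only [tensorHom_def', whiskerLeft_zero', Limits.zero_comp, Limits.comp_zero]
        | add f g h₁ h₂ =>
          simp only [tensorHom_def', whiskerLeft_add', Preadditive.add_comp,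
            Preadditive.comp_add] at h₁ h₂ ⊢
          rw [h₁, h₂]
        | tm c f₃ =>
          rw [associator_hom, associator_hom]
          simp only [tm_tensor_tm, tm_comp_tm, tensorObj_obj, mul_one, one_mul, mul_assoc]
          exact congrArg (tm _) (associator_naturality f₁ f₂ f₃)
  leftUnitor_naturality f := by
    induction f using hom_induction with
    | zero => simp only [whiskerLeft_zero', Limits.zero_comp, Limits.comp_zero]
    | add f g h₁ h₂ =>
      simp only [whiskerLeft_add', Preadditive.add_comp, Preadditive.comp_add, h₁, h₂]
    | tm a f =>
      rw [leftUnitor_hom, leftUnitor_hom, whiskerLeft_tm, tm_comp_tm, tm_comp_tm, mul_one, one_mul]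
      exact congrArg (tm _) (leftUnitor_naturality f)
  rightUnitor_naturality f := by
    induction f using hom_induction with
    | zero => simp only [zero_whiskerRight', Limits.zero_comp, Limits.comp_zero]
    | add f g h₁ h₂ =>
      simp only [add_whiskerRight', Preadditive.add_comp, Preadditive.comp_add, h₁, h₂]
    | tm a f =>
      rw [rightUnitor_hom, rightUnitor_hom, tm_whiskerRight, tm_comp_tm, tm_comp_tm, mul_one,
        one_mul]
      exact congrArg (tm _) (rightUnitor_naturality f)
  pentagon W X Y Z := by
    simp only [associator_hom, tm_whiskerRight, whiskerLeft_tm, tm_comp_tm, mul_one]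
    exact congrArg (tm _) (pentagon W.obj X.obj Y.obj Z.obj)
  triangle X Y := by
    simp only [associator_hom, leftUnitor_hom, rightUnitor_hom, tm_whiskerRight, whiskerLeft_tm,
      tm_comp_tm, mul_one]
    exact congrArg (tm _) (triangle X.obj Y.obj)

/-- The braiding of `C_Λ` is that of `C`. -/
noncomputable instance [BraidedCategory C] : BraidedCategory (BaseChange F C Λ) where
  braiding X Y := (incl F C Λ).mapIso (β_ X.obj Y.obj)
  braiding_naturality_right X Y Z f := by
    induction f using hom_induction with
    | zero => simp only [zero_whiskerRight', whiskerLeft_zero', Limits.zero_comp, Limits.comp_zero]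
    | add f g h₁ h₂ =>
      simp only [add_whiskerRight', whiskerLeft_add', Preadditive.add_comp, Preadditive.comp_add,
        h₁, h₂]
    | tm a f =>
      refine (tm_comp_tm ..).trans (Eq.trans ?_ (tm_comp_tm ..).symm)
      rw [mul_one, one_mul]
      exact congrArg (tm _) (BraidedCategory.braiding_naturality_right X.obj f)
  braiding_naturality_left {X Y} f Z := by
    induction f using hom_induction with
    | zero => simp only [zero_whiskerRight', whiskerLeft_zero', Limits.zero_comp, Limits.comp_zero]
    | add f g h₁ h₂ =>
      simp only [add_whiskerRight', whiskerLeft_add', Preadditive.add_comp, Preadditive.comp_add,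
        h₁, h₂]
    | tm a f =>
      refine (tm_comp_tm ..).trans (Eq.trans ?_ (tm_comp_tm ..).symm)
      rw [mul_one, one_mul]
      exact congrArg (tm _) (BraidedCategory.braiding_naturality_left f Z.obj)
  hexagon_forward X Y Z := by
    simp only [associator_hom, Functor.mapIso_hom, incl_map]
    simp only [tm_whiskerRight, whiskerLeft_tm]
    refine ((congrArg _ (tm_comp_tm ..)).trans (tm_comp_tm ..)).trans
      (Eq.trans ?_ ((congrArg _ (tm_comp_tm ..)).trans (tm_comp_tm ..)).symm)
    exact congrArg (tm _) (BraidedCategory.hexagon_forward X.obj Y.obj Z.obj)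
  hexagon_reverse X Y Z := by
    change (incl F C Λ).map _ ≫ (incl F C Λ).map _ ≫ (incl F C Λ).map _ =
      X ◁ tm 1 _ ≫ (incl F C Λ).map _ ≫ tm 1 _ ▷ Y
    simp only [tm_whiskerRight, whiskerLeft_tm, incl_map]
    refine ((congrArg _ (tm_comp_tm ..)).trans (tm_comp_tm ..)).trans
      (Eq.trans ?_ ((congrArg _ (tm_comp_tm ..)).trans (tm_comp_tm ..)).symm)
    exact congrArg (tm _) (BraidedCategory.hexagon_reverse X.obj Y.obj Z.obj)

noncomputable instance [SymmetricCategory C] : SymmetricCategory (BaseChange F C Λ) where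
  symmetry X Y := by
    change (incl F C Λ).map _ ≫ (incl F C Λ).map _ = _
    rw [← Functor.map_comp, SymmetricCategory.symmetry]
    rfl

noncomputable instance : MonoidalPreadditive (BaseChange F C Λ) where
  whiskerLeft_zero := whiskerLeft_zero' _ _ _
  zero_whiskerRight := zero_whiskerRight' _ _ _
  whiskerLeft_add f g := whiskerLeft_add' _ f g
  add_whiskerRight f g := add_whiskerRight' _ f g

section Map

variable {Λ' : Type u} [CommRing Λ'] [Algebra F Λ']

/-- The transition functors `C_Λ ⥤ C_Λ'` are strictly monoidal. -/
noncomputable instance (φ : Λ →ₐ[F] Λ') : (map (C := C) φ).Monoidal :=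
  Functor.CoreMonoidal.toMonoidal
    { εIso := Iso.refl (𝟙_ (BaseChange F C Λ'))
      μIso := fun X Y => Iso.refl (⟨X.obj ⊗ Y.obj⟩ : BaseChange F C Λ')
      μIso_hom_natural_left := fun {X Y} f Z => by
        refine (Category.comp_id _).trans (Eq.trans ?_ (Category.id_comp _).symm)
        induction f using hom_induction with
        | zero =>
          rw [Functor.map_zero, zero_whiskerRight', zero_whiskerRight', Functor.map_zero]; rfl
        | add f g h₁ h₂ =>
          rw [Functor.map_add, add_whiskerRight', add_whiskerRight', Functor.map_add, h₁, h₂]; rfl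
        | tm a f => rfl
      μIso_hom_natural_right := fun {X Y} Z f => by
        refine (Category.comp_id _).trans (Eq.trans ?_ (Category.id_comp _).symm)
        induction f using hom_induction with
        | zero =>
          rw [Functor.map_zero, whiskerLeft_zero', whiskerLeft_zero', Functor.map_zero]; rfl
        | add f g h₁ h₂ =>
          rw [Functor.map_add, whiskerLeft_add', whiskerLeft_add', Functor.map_add, h₁, h₂]; rfl
        | tm a f => rfl
      associativity := fun X Y Z => by
        let X' : BaseChange F C Λ' := ⟨X.obj⟩
        let Y' : BaseChange F C Λ' := ⟨Y.obj⟩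
        let Z' : BaseChange F C Λ' := ⟨Z.obj⟩
        have h : (map φ).map (α_ X Y Z).hom = (α_ X' Y' Z').hom := by
          rw [associator_hom, map_tm, map_one]; rfl
        rw [h]
        change 𝟙 (X' ⊗ Y') ▷ Z' ≫ 𝟙 ((X' ⊗ Y') ⊗ Z') ≫ (α_ X' Y' Z').hom =
          (α_ X' Y' Z').hom ≫ X' ◁ 𝟙 (Y' ⊗ Z') ≫ 𝟙 (X' ⊗ Y' ⊗ Z')
        simp
      left_unitality := fun X => by
        let X' : BaseChange F C Λ' := ⟨X.obj⟩
        have h : (map φ).map (λ_ X).hom = (λ_ X').hom := by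
          rw [leftUnitor_hom, map_tm, map_one]; rfl
        rw [h]
        change (λ_ X').hom = 𝟙 (𝟙_ _) ▷ X' ≫ 𝟙 (𝟙_ _ ⊗ X') ≫ (λ_ X').hom
        simp
      right_unitality := fun X => by
        let X' : BaseChange F C Λ' := ⟨X.obj⟩
        have h : (map φ).map (ρ_ X).hom = (ρ_ X').hom := by
          rw [rightUnitor_hom, map_tm, map_one]; rfl
        rw [h]
        change (ρ_ X').hom = X' ◁ 𝟙 (𝟙_ _) ≫ 𝟙 (X' ⊗ 𝟙_ _) ≫ (ρ_ X').hom
        simp }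

theorem map_ε (φ : Λ →ₐ[F] Λ') :
    Functor.LaxMonoidal.ε (map (C := C) φ) = 𝟙 (𝟙_ (BaseChange F C Λ')) := rfl

theorem map_μ (φ : Λ →ₐ[F] Λ') (X Y : BaseChange F C Λ) :
    Functor.LaxMonoidal.μ (map (C := C) φ) X Y =
      𝟙 (⟨X.obj ⊗ Y.obj⟩ : BaseChange F C Λ') := rfl

end Map

end Monoidal

end BaseChange

/-! ## Actions of abstract groups on categories, and equivariant objects -/

/-- An action of the abstract group `G` on the category `D`. -/
structure GrpAction (G : Type u) [Group G] (D : Type w) [Category.{v} D] where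
  /-- the functor `g · -` -/
  act : G → D ⥤ D
  /-- `1 · - ≅ id` -/
  one : act 1 ≅ 𝟭 D
  /-- `g₂ · (g₁ · -) ≅ (g₂ g₁) · -` -/
  mul : ∀ g₂ g₁ : G, act g₁ ⋙ act g₂ ≅ act (g₂ * g₁)
  one_mul : ∀ (g : G) (X : D),
    (mul 1 g).hom.app X ≫
      eqToHom (congrArg (fun k => (act k).obj X) (_root_.one_mul g)) = one.hom.app ((act g).obj X)
  mul_one : ∀ (g : G) (X : D),
    (mul g 1).hom.app X ≫
      eqToHom (congrArg (fun k => (act k).obj X) (_root_.mul_one g)) = (act g).map (one.hom.app X)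
  assoc : ∀ (g₃ g₂ g₁ : G) (X : D),
    (mul g₃ g₂).hom.app ((act g₁).obj X) ≫ (mul (g₃ * g₂) g₁).hom.app X ≫
        eqToHom (congrArg (fun k => (act k).obj X) (mul_assoc g₃ g₂ g₁)) =
      (act g₃).map ((mul g₂ g₁).hom.app X) ≫ (mul g₃ (g₂ * g₁)).hom.app X

namespace GrpAction

section Basic

variable {G : Type u} [Group G] {D : Type w} [Category.{v} D] (A : GrpAction G D)

/-- The structure of an equivariant object on `X : D`: isomorphisms `α_g : g · X ≅ X` satisfying
the cocycle condition, with `α_1` the canonical isomorphism. -/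
@[ext]
structure EquivStr (X : D) where
  /-- the isomorphism `α_g` -/
  iso : ∀ g : G, (A.act g).obj X ≅ X
  iso_one : (iso 1).hom = A.one.hom.app X
  iso_mul : ∀ g₂ g₁ : G,
    (A.mul g₂ g₁).hom.app X ≫ (iso (g₂ * g₁)).hom = (A.act g₂).map (iso g₁).hom ≫ (iso g₂).hom

variable {A}

/-- A morphism `f : X ⟶ Y` is equivariant if `α_g ≫ f = (g · f) ≫ β_g` for all `g`. -/
def EquivStr.IsEquivariant {X Y : D} (s : A.EquivStr X) (t : A.EquivStr Y) (f : X ⟶ Y) : Prop :=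
  ∀ g : G, (A.act g).map f ≫ (t.iso g).hom = (s.iso g).hom ≫ f

theorem EquivStr.IsEquivariant.id {X : D} (s : A.EquivStr X) : s.IsEquivariant s (𝟙 X) :=
  fun g => by simp

theorem EquivStr.IsEquivariant.comp {X Y Z : D} {s : A.EquivStr X} {t : A.EquivStr Y}
    {r : A.EquivStr Z} {f : X ⟶ Y} {g : Y ⟶ Z} (hf : s.IsEquivariant t f)
    (hg : t.IsEquivariant r g) : s.IsEquivariant r (f ≫ g) := fun q => by
  rw [Functor.map_comp, Category.assoc, hg q, ← Category.assoc, hf q, Category.assoc]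

theorem EquivStr.IsEquivariant.inv {X Y : D} {s : A.EquivStr X} {t : A.EquivStr Y}
    {f : X ≅ Y} (hf : s.IsEquivariant t f.hom) : t.IsEquivariant s f.inv := fun g => by
  rw [← cancel_epi ((A.act g).map f.hom), ← Functor.map_comp_assoc, ← Category.assoc, hf g]
  simp

end Basic

section Monoidal

variable {G : Type u} [Group G] {D : Type w} [Category.{v} D] [MonoidalCategory D]
  [BraidedCategory D] (A : GrpAction G D)

/-- A (unitary, symmetric) monoidal structure on an action of `G` on a symmetric monoidal
category `D`: each `g · -` is a unitary symmetric strong monoidal functor, and the structural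
isomorphisms of the action are monoidal. -/
class Monoidal where
  braided : ∀ g : G, (A.act g).Braided
  one_isMonoidal : NatTrans.IsMonoidal A.one.hom
  mul_isMonoidal : ∀ g₂ g₁ : G, NatTrans.IsMonoidal (A.mul g₂ g₁).hom

attribute [reducible] Monoidal.braided

attribute [instance] Monoidal.braided Monoidal.one_isMonoidal Monoidal.mul_isMonoidal

open Functor.LaxMonoidal Functor.OplaxMonoidal Functor.Monoidal

variable {A} [A.Monoidal]

/-- The tensor product of two equivariant objects:
`g · (X ⊗ Y) ≅ (g · X) ⊗ (g · Y) ≅ X ⊗ Y`. -/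
@[simps iso]
def EquivStr.tensor {X Y : D} (s : A.EquivStr X) (t : A.EquivStr Y) : A.EquivStr (X ⊗ Y) where
  iso g := (μIso (A.act g) X Y).symm ≪≫ (s.iso g ⊗ᵢ t.iso g)
  iso_one := by
    have h := NatTrans.IsMonoidal.tensor (τ := A.one.hom) X Y
    simp only [id_μ, Functor.id_obj, Category.comp_id] at h
    rw [← cancel_epi (μ (A.act 1) X Y), h]
    simp only [Iso.trans_hom, Iso.symm_hom, μIso_inv, tensorIso_hom, μ_δ_assoc, s.iso_one,
      t.iso_one]
  iso_mul g₂ g₁ := by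
    have h := NatTrans.IsMonoidal.tensor (τ := (A.mul g₂ g₁).hom) X Y
    have h₁ := s.iso_mul g₂ g₁
    have h₂ := t.iso_mul g₂ g₁
    rw [← cancel_epi (μ (A.act g₁ ⋙ A.act g₂) X Y), ← Category.assoc, h]
    simp only [Functor.comp_obj, comp_μ, Iso.trans_hom, Iso.symm_hom, μIso_inv, tensorIso_hom,
      Category.assoc, Functor.map_comp, μ_δ_assoc]
    rw [tensorHom_comp_tensorHom, h₁, h₂, ← Functor.map_comp_assoc _ (μ _ _ _) (δ _ _ _), μ_δ,
      CategoryTheory.Functor.map_id, Category.id_comp, ← tensorHom_comp_tensorHom, ← μ_natural_assoc, μ_δ_assoc]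

theorem EquivStr.μ_tensor {X Y : D} (s : A.EquivStr X) (t : A.EquivStr Y) (g : G) :
    μ (A.act g) X Y ≫ ((s.tensor t).iso g).hom = (s.iso g).hom ⊗ₘ (t.iso g).hom := by
  simp

/-- The unit equivariant object: `g · 𝟙 ≅ 𝟙`. -/
@[simps iso]
def EquivStr.unit : A.EquivStr (𝟙_ D) where
  iso g := (εIso (A.act g)).symm
  iso_one := by
    have h := NatTrans.IsMonoidal.unit (τ := A.one.hom)
    rw [← cancel_epi (ε (A.act 1)), h]
    simp
  iso_mul g₂ g₁ := by
    have h := NatTrans.IsMonoidal.unit (τ := (A.mul g₂ g₁).hom)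
    rw [← cancel_epi (ε (A.act g₁ ⋙ A.act g₂)), ← Category.assoc, h]
    simp

theorem EquivStr.ε_unit (g : G) :
    ε (A.act g) ≫ ((EquivStr.unit (A := A)).iso g).hom = 𝟙 (𝟙_ D) := by
  simp

namespace EquivStr.IsEquivariant

theorem whiskerLeft {X Y Z : D} (r : A.EquivStr X) {s : A.EquivStr Y} {t : A.EquivStr Z}
    {f : Y ⟶ Z} (hf : s.IsEquivariant t f) :
    (r.tensor s).IsEquivariant (r.tensor t) (X ◁ f) := fun g => by
  rw [← cancel_epi (μ (A.act g) X Y), ← μ_natural_right_assoc, μ_tensor, ← Category.assoc,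
    μ_tensor, ← id_tensorHom, tensorHom_comp_tensorHom, ← id_tensorHom, tensorHom_comp_tensorHom,
    hf g, Category.id_comp, Category.comp_id]

theorem whiskerRight {X Y Z : D} (r : A.EquivStr X) {s : A.EquivStr Y} {t : A.EquivStr Z}
    {f : Y ⟶ Z} (hf : s.IsEquivariant t f) :
    (s.tensor r).IsEquivariant (t.tensor r) (f ▷ X) := fun g => by
  rw [← cancel_epi (μ (A.act g) Y X), ← μ_natural_left_assoc, μ_tensor, ← Category.assoc,
    μ_tensor, ← tensorHom_id, tensorHom_comp_tensorHom, ← tensorHom_id, tensorHom_comp_tensorHom,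
    hf g, Category.id_comp, Category.comp_id]

theorem associator {X Y Z : D} (r : A.EquivStr X) (s : A.EquivStr Y) (t : A.EquivStr Z) :
    ((r.tensor s).tensor t).IsEquivariant (r.tensor (s.tensor t)) (α_ X Y Z).hom := fun g => by
  rw [← cancel_epi (μ (A.act g) (X ⊗ Y) Z), ← cancel_epi (μ (A.act g) X Y ▷ (A.act g).obj Z),
    Functor.LaxMonoidal.associativity_assoc, μ_tensor, ← Category.assoc (μ (A.act g) (X ⊗ Y) Z), μ_tensor,
    ← id_tensorHom, tensorHom_comp_tensorHom, μ_tensor, ← tensorHom_id,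
    ← Category.assoc (_ ⊗ₘ _) (_ ⊗ₘ _), tensorHom_comp_tensorHom, μ_tensor, Category.id_comp,
    Category.id_comp, associator_naturality]

theorem leftUnitor {X : D} (r : A.EquivStr X) :
    (unit.tensor r).IsEquivariant r (λ_ X).hom := fun g => by
  rw [← cancel_epi (μ (A.act g) (𝟙_ D) X), ← cancel_epi (ε (A.act g) ▷ (A.act g).obj X),
    ← Functor.LaxMonoidal.left_unitality_assoc, ← Category.assoc (μ (A.act g) (𝟙_ D) X), μ_tensor, ← tensorHom_id,
    ← Category.assoc (_ ⊗ₘ _) (_ ⊗ₘ _), tensorHom_comp_tensorHom, ε_unit, Category.id_comp,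
    id_tensorHom, leftUnitor_naturality]

theorem rightUnitor {X : D} (r : A.EquivStr X) :
    (r.tensor unit).IsEquivariant r (ρ_ X).hom := fun g => by
  rw [← cancel_epi (μ (A.act g) X (𝟙_ D)), ← cancel_epi ((A.act g).obj X ◁ ε (A.act g)),
    ← Functor.LaxMonoidal.right_unitality_assoc, ← Category.assoc (μ (A.act g) X (𝟙_ D)), μ_tensor, ← id_tensorHom,
    ← Category.assoc (_ ⊗ₘ _) (_ ⊗ₘ _), tensorHom_comp_tensorHom, ε_unit, Category.id_comp,
    tensorHom_id, rightUnitor_naturality]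

theorem braiding {X Y : D} (r : A.EquivStr X) (s : A.EquivStr Y) :
    (r.tensor s).IsEquivariant (s.tensor r) (β_ X Y).hom := fun g => by
  simp [Functor.map_braiding]

end EquivStr.IsEquivariant

end Monoidal

end GrpAction

/-! ## `F`-algebraic actions of pro-algebraic groups, and equivariant objects

A pro-algebraic group `Q` over `F` is an affine group scheme `Q = Spec H` over `F`, given by its
commutative Hopf algebra `H`. -/

/-- The group `Q(Λ) = Hom_{F-alg}(H, Λ)` of `Λ`-points of `Q = Spec H`. Its multiplication is
convolution with respect to the comultiplication of `H`. -/
abbrev Points (F H Λ : Type u) [Field F] [CommRing H] [HopfAlgebra F H] [CommRing Λ]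
    [Algebra F Λ] : Type u :=
  WithConv (H →ₐ[F] Λ)

namespace Points

variable {F H : Type u} [Field F] [CommRing H] [HopfAlgebra F H]
variable {Λ Λ' : Type u} [CommRing Λ] [Algebra F Λ] [CommRing Λ'] [Algebra F Λ']

/-- The group structure on `Q(Λ)`: its monoid structure is Mathlib's convolution of algebra
homomorphisms `H → Λ`, and the inverse of `q` is `q ∘ S` for the antipode `S` of `H`. -/
noncomputable instance : Group (Points F H Λ) where
  inv q := WithConv.toConv (q.ofConv.comp (HopfAlgebra.antipodeAlgHom F H))
  inv_mul_cancel q := by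
    have hq : (Algebra.TensorProduct.lmul' F).comp
        (Algebra.TensorProduct.map q.ofConv q.ofConv) =
          q.ofConv.comp (Algebra.TensorProduct.lmul' F) := by ext <;> simp
    trans WithConv.toConv <| ((Algebra.TensorProduct.lmul' F).comp
      (Algebra.TensorProduct.map q.ofConv q.ofConv)).comp
        ((Algebra.TensorProduct.map (HopfAlgebra.antipodeAlgHom F H) (.id _ _)).comp
          (Bialgebra.comulAlgHom F H))
    · rw [AlgHom.comp_assoc, ← AlgHom.comp_assoc (Algebra.TensorProduct.map q.ofConv q.ofConv),
        ← Algebra.TensorProduct.map_comp]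
      rfl
    rw [hq, AlgHom.comp_assoc, WithConv.ext_iff, ← AlgHom.toLinearMap_injective.eq_iff]
    change q.ofConv.toLinearMap.comp
        (WithConv.toConv (HopfAlgebra.antipode F (A := H)) * WithConv.toConv LinearMap.id).ofConv =
      (1 : WithConv (H →ₗ[F] Λ)).ofConv
    rw [LinearMap.antipode_mul_id]
    ext
    simp

/-- The map `Q(Λ) → Q(Λ')` induced by an `F`-algebra homomorphism `φ : Λ → Λ'`. -/
def map (φ : Λ →ₐ[F] Λ') (q : Points F H Λ) : Points F H Λ' :=
  WithConv.toConv (φ.comp q.ofConv)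

theorem map_one (φ : Λ →ₐ[F] Λ') : map φ (1 : Points F H Λ) = 1 := by
  apply WithConv.ofConv_injective
  ext h
  exact φ.commutes _

theorem map_mul (φ : Λ →ₐ[F] Λ') (q₂ q₁ : Points F H Λ) :
    map φ (q₂ * q₁) = map φ q₂ * map φ q₁ :=
  WithConv.ofConv_injective (AlgHom.comp_convMul_distrib φ q₂ q₁)

end Points

/-- An `F`-algebraic action of `Q = Spec H` on the `F`-linear category `C`: for every commutative
`F`-algebra `Λ`, a `Λ`-linear action of the group `Q(Λ)` on `C_Λ`, functorially in `Λ`.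

Functoriality means that for `φ : Λ → Λ'` and `q ∈ Q(Λ)` the square formed by `q · -`, `φ(q) · -`
and the transition functor `C_Λ ⥤ C_Λ'` commutes, up to a given natural isomorphism `base φ q`
(the identity if the square commutes strictly); these isomorphisms are compatible with composition
of algebra homomorphisms (hence equal to the identity for `φ = id`) and with the isomorphisms
`1 · - ≅ id` and `q₂ · (q₁ · -) ≅ (q₂ q₁) · -`. -/
structure AlgAction (F H : Type u) [Field F] [CommRing H] [HopfAlgebra F H]
    (C : Type w) [Category.{v} C] [Preadditive C] [Linear F C] where
  /-- the action of the abstract group `Q(Λ)` on `C_Λ` -/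
  action : ∀ (Λ : Type u) [CommRing Λ] [Algebra F Λ],
    GrpAction (Points F H Λ) (BaseChange F C Λ)
  additive : ∀ (Λ : Type u) [CommRing Λ] [Algebra F Λ] (q : Points F H Λ),
    ((action Λ).act q).Additive
  linear : ∀ (Λ : Type u) [CommRing Λ] [Algebra F Λ] (q : Points F H Λ),
    ((action Λ).act q).Linear Λ
  /-- the isomorphism `(q · -) ⊗_Λ Λ' ≅ φ(q) · (- ⊗_Λ Λ')` -/
  base : ∀ {Λ Λ' : Type u} [CommRing Λ] [Algebra F Λ] [CommRing Λ'] [Algebra F Λ']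
    (φ : Λ →ₐ[F] Λ') (q : Points F H Λ),
    (action Λ).act q ⋙ BaseChange.map φ ≅ BaseChange.map φ ⋙ (action Λ').act (Points.map φ q)
  base_comp : ∀ {Λ Λ' Λ'' : Type u} [CommRing Λ] [Algebra F Λ] [CommRing Λ'] [Algebra F Λ']
    [CommRing Λ''] [Algebra F Λ''] (φ : Λ →ₐ[F] Λ') (ψ : Λ' →ₐ[F] Λ'') (q : Points F H Λ)
    (X : BaseChange F C Λ),
    (base (ψ.comp φ) q).hom.app X =
      (BaseChange.map ψ).map ((base φ q).hom.app X) ≫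
        (base ψ (Points.map φ q)).hom.app ((BaseChange.map φ).obj X)
  base_one : ∀ {Λ Λ' : Type u} [CommRing Λ] [Algebra F Λ] [CommRing Λ'] [Algebra F Λ']
    (φ : Λ →ₐ[F] Λ') (X : BaseChange F C Λ),
    (base φ 1).hom.app X ≫
        eqToHom (congrArg (fun k => ((action Λ').act k).obj ((BaseChange.map φ).obj X))
          (Points.map_one φ)) ≫
        (action Λ').one.hom.app ((BaseChange.map φ).obj X) =
      (BaseChange.map φ).map ((action Λ).one.hom.app X)
  base_mul : ∀ {Λ Λ' : Type u} [CommRing Λ] [Algebra F Λ] [CommRing Λ'] [Algebra F Λ']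
    (φ : Λ →ₐ[F] Λ') (q₂ q₁ : Points F H Λ) (X : BaseChange F C Λ),
    (BaseChange.map φ).map (((action Λ).mul q₂ q₁).hom.app X) ≫
        (base φ (q₂ * q₁)).hom.app X ≫
        eqToHom (congrArg (fun k => ((action Λ').act k).obj ((BaseChange.map φ).obj X))
          (Points.map_mul φ q₂ q₁)) =
      (base φ q₂).hom.app (((action Λ).act q₁).obj X) ≫
        ((action Λ').act (Points.map φ q₂)).map ((base φ q₁).hom.app X) ≫
        ((action Λ').mul (Points.map φ q₂) (Points.map φ q₁)).hom.app ((BaseChange.map φ).obj X)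

namespace AlgAction

attribute [instance] AlgAction.additive AlgAction.linear

section Basic

variable {F H : Type u} [Field F] [CommRing H] [HopfAlgebra F H]
variable {C : Type w} [Category.{v} C] [Preadditive C] [Linear F C] (A : AlgAction F H C)

/-- The structure of an `F`-algebraic equivariant object on `X : C`: for every `Λ`, the structure
`(α_{Λ,q})_q` of an equivariant object on `X ⊗ Λ` under the action of `Q(Λ)` on `C_Λ`, such that
`α_{Λ,q} ⊗ 1` corresponds to `α_{Λ',φ(q)}` for every `φ : Λ → Λ'`. -/
structure EquivStr (X : C) where
  /-- the family `α_Λ` -/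
  str : ∀ (Λ : Type u) [CommRing Λ] [Algebra F Λ],
    (A.action Λ).EquivStr (⟨X⟩ : BaseChange F C Λ)
  base : ∀ {Λ Λ' : Type u} [CommRing Λ] [Algebra F Λ] [CommRing Λ'] [Algebra F Λ']
    (φ : Λ →ₐ[F] Λ') (q : Points F H Λ),
    (BaseChange.map φ).map ((str Λ).iso q).hom =
      (A.base φ q).hom.app (⟨X⟩ : BaseChange F C Λ) ≫ ((str Λ').iso (Points.map φ q)).hom

/-- The objects of the category `C^Q` of `F`-algebraic equivariant objects. -/
structure EquivObj where
  /-- the underlying object of `C` -/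
  obj : C
  /-- the family of isomorphisms `α` -/
  equivStr : A.EquivStr obj

namespace EquivObj

variable {A}

/-- The morphisms `X ⟶ Y` of `C^Q`, as an `F`-linear subspace of the space of morphisms of `C`:
those `f` such that `f ⊗ 1` is `Q(Λ)`-equivariant for every `Λ`. -/
def homs (X Y : A.EquivObj) : Submodule F (X.obj ⟶ Y.obj) where
  carrier := {f | ∀ (Λ : Type u) [CommRing Λ] [Algebra F Λ],
    (X.equivStr.str Λ).IsEquivariant (Y.equivStr.str Λ) ((BaseChange.incl F C Λ).map f)}
  zero_mem' Λ _ _ q := by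
    rw [BaseChange.incl_map, BaseChange.tm_zero, Functor.map_zero]
    simp
  add_mem' {f g} hf hg Λ _ _ q := by
    have h₁ := hf Λ q
    have h₂ := hg Λ q
    rw [BaseChange.incl_map] at h₁ h₂ ⊢
    rw [BaseChange.tm_add, Functor.map_add, Preadditive.add_comp, Preadditive.comp_add, h₁, h₂]
  smul_mem' r f hf Λ _ _ q := by
    have h₁ := hf Λ q
    rw [BaseChange.incl_map] at h₁ ⊢
    rw [BaseChange.tm_smul, Functor.map_smul, Linear.smul_comp, Linear.comp_smul, h₁]

instance : Category A.EquivObj where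
  Hom X Y := X.homs Y
  id X := ⟨𝟙 X.obj, fun Λ _ _ => GrpAction.EquivStr.IsEquivariant.id _⟩
  comp f g := ⟨f.1 ≫ g.1, fun Λ _ _ => by
    rw [Functor.map_comp]
    exact (f.2 Λ).comp (g.2 Λ)⟩
  id_comp f := Subtype.ext (Category.id_comp f.1)
  comp_id f := Subtype.ext (Category.comp_id f.1)
  assoc f g h := Subtype.ext (Category.assoc f.1 g.1 h.1)

@[ext]
theorem hom_ext {X Y : A.EquivObj} {f g : X ⟶ Y} (h : f.1 = g.1) : f = g := Subtype.ext h

instance : Preadditive A.EquivObj where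
  homGroup X Y := inferInstanceAs (AddCommGroup (X.homs Y))
  add_comp _ _ _ f f' g := Subtype.ext (Preadditive.add_comp _ _ _ f.1 f'.1 g.1)
  comp_add _ _ _ f g g' := Subtype.ext (Preadditive.comp_add _ _ _ f.1 g.1 g'.1)

instance : Linear F A.EquivObj where
  homModule X Y := inferInstanceAs (Module F (X.homs Y))
  smul_comp _ _ _ r f g := Subtype.ext (Linear.smul_comp _ _ _ r f.1 g.1)
  comp_smul _ _ _ f r g := Subtype.ext (Linear.comp_smul _ _ _ f.1 r g.1)

end EquivObj

/-- The forgetful functor `C^Q ⥤ C`. -/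
@[simps obj]
def forget : A.EquivObj ⥤ C where
  obj X := X.obj
  map f := f.1

instance : A.forget.Faithful where
  map_injective h := Subtype.ext h

instance : A.forget.Additive where

instance : A.forget.Linear F where

variable {A}

/-- An isomorphism of `C` that is a morphism of `C^Q` is an isomorphism of `C^Q`. -/
def EquivObj.mkIso {X Y : A.EquivObj} (e : X.obj ≅ Y.obj) (he : e.hom ∈ X.homs Y) : X ≅ Y where
  hom := ⟨e.hom, he⟩
  inv := ⟨e.inv, fun Λ _ _ =>
    GrpAction.EquivStr.IsEquivariant.inv (f := (BaseChange.incl F C Λ).mapIso e) (he Λ)⟩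
  hom_inv_id := Subtype.ext e.hom_inv_id
  inv_hom_id := Subtype.ext e.inv_hom_id

end Basic

section Monoidal

variable {F H : Type u} [Field F] [CommRing H] [HopfAlgebra F H]
variable {C : Type w} [Category.{v} C] [Preadditive C] [Linear F C] [MonoidalCategory C]
  [SymmetricCategory C] [MonoidalPreadditive C] [MonoidalLinear F C] (A : AlgAction F H C)

/-- A (unitary, symmetric) monoidal structure on an `F`-algebraic action: the actions of the groups
`Q(Λ)` on `C_Λ` are (unitary, symmetric) monoidal, functorially in `Λ`. -/
class Monoidal where
  action : ∀ (Λ : Type u) [CommRing Λ] [Algebra F Λ], (A.action Λ).Monoidal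
  base_isMonoidal : ∀ {Λ Λ' : Type u} [CommRing Λ] [Algebra F Λ] [CommRing Λ'] [Algebra F Λ']
    (φ : Λ →ₐ[F] Λ') (q : Points F H Λ), NatTrans.IsMonoidal (A.base φ q).hom

attribute [reducible] Monoidal.action

attribute [instance] Monoidal.action Monoidal.base_isMonoidal

variable {A} [A.Monoidal]

open Functor.LaxMonoidal Functor.OplaxMonoidal Functor.Monoidal

theorem map_eq_of_tensor {D : Type*} [Category* D] [MonoidalCategory D] {D' : Type*} [Category* D']
    [MonoidalCategory D'] {R : D ⥤ D} {M : D ⥤ D'} {R' : D' ⥤ D'} [R.Monoidal] [M.Monoidal]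
    [R'.Monoidal] (θ : R ⋙ M ⟶ M ⋙ R') [NatTrans.IsMonoidal θ] {X Y : D}
    {s : R.obj X ⟶ X} {t : R.obj Y ⟶ Y} {r : R.obj (X ⊗ Y) ⟶ X ⊗ Y}
    {s' : R'.obj (M.obj X) ⟶ M.obj X} {t' : R'.obj (M.obj Y) ⟶ M.obj Y}
    {r' : R'.obj (M.obj (X ⊗ Y)) ⟶ M.obj (X ⊗ Y)}
    (hs : M.map s = θ.app X ≫ s') (ht : M.map t = θ.app Y ≫ t') (hr : μ R X Y ≫ r = s ⊗ₘ t)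
    (hr' : μ R' _ _ ≫ R'.map (μ M X Y) ≫ r' = (s' ⊗ₘ t') ≫ μ M X Y) :
    M.map r = θ.app (X ⊗ Y) ≫ r' := by
  have h := NatTrans.IsMonoidal.tensor (τ := θ) X Y
  rw [← cancel_epi (μ (R ⋙ M) X Y), reassoc_of% h, comp_μ, comp_μ, Category.assoc, Category.assoc,
    hr', ← Functor.map_comp, hr, ← μ_natural, hs, ht, ← tensorHom_comp_tensorHom, Category.assoc]

theorem map_eq_of_unit {D : Type*} [Category* D] [MonoidalCategory D] {D' : Type*} [Category* D']
    [MonoidalCategory D'] {R : D ⥤ D} {M : D ⥤ D'} {R' : D' ⥤ D'} [R.Monoidal] [M.Monoidal]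
    [R'.Monoidal] (θ : R ⋙ M ⟶ M ⋙ R') [NatTrans.IsMonoidal θ]
    {r : R.obj (𝟙_ D) ⟶ 𝟙_ D} {r' : R'.obj (M.obj (𝟙_ D)) ⟶ M.obj (𝟙_ D)}
    (hr : ε R ≫ r = 𝟙 _) (hr' : ε R' ≫ R'.map (ε M) ≫ r' = ε M) :
    M.map r = θ.app (𝟙_ D) ≫ r' := by
  have h := NatTrans.IsMonoidal.unit (τ := θ)
  rw [← cancel_epi (ε (R ⋙ M)), reassoc_of% h, comp_ε, comp_ε, Category.assoc, Category.assoc,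
    hr', ← Functor.map_comp, hr, CategoryTheory.Functor.map_id, Category.comp_id]

/-- The tensor product of two `F`-algebraic equivariant objects. -/
noncomputable def EquivStr.tensor {X Y : C} (s : A.EquivStr X) (t : A.EquivStr Y) : A.EquivStr (X ⊗ Y) where
  str Λ _ _ := GrpAction.EquivStr.tensor (s.str Λ) (t.str Λ)
  base {Λ Λ'} _ _ _ _ φ q := by
    refine map_eq_of_tensor (A.base φ q).hom (X := (⟨X⟩ : BaseChange F C Λ))
      (Y := (⟨Y⟩ : BaseChange F C Λ)) (s.base φ q) (t.base φ q)
      (GrpAction.EquivStr.μ_tensor (s.str Λ) (t.str Λ) q) ?_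
    rw [BaseChange.map_μ]
    erw [CategoryTheory.Functor.map_id, Category.id_comp, Category.comp_id]
    exact GrpAction.EquivStr.μ_tensor (s.str Λ') (t.str Λ') (Points.map φ q)

/-- The unit `F`-algebraic equivariant object. -/
noncomputable def EquivStr.unit : A.EquivStr (𝟙_ C) where
  str Λ _ _ := GrpAction.EquivStr.unit
  base {Λ Λ'} _ _ _ _ φ q := by
    refine map_eq_of_unit (A.base φ q).hom (GrpAction.EquivStr.ε_unit (A := A.action Λ) q) ?_
    rw [BaseChange.map_ε]
    erw [CategoryTheory.Functor.map_id, Category.id_comp]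
    exact GrpAction.EquivStr.ε_unit (A := A.action Λ') (Points.map φ q)

section

variable {X Y Z : C} (r : A.EquivStr X) (s : A.EquivStr Y) (t : A.EquivStr Z)

theorem EquivStr.whiskerLeft_mem {s : A.EquivStr Y} {t : A.EquivStr Z} {f : Y ⟶ Z}
    (hf : f ∈ EquivObj.homs ⟨Y, s⟩ ⟨Z, t⟩) :
    X ◁ f ∈ EquivObj.homs ⟨X ⊗ Y, r.tensor s⟩ ⟨X ⊗ Z, r.tensor t⟩ := fun Λ _ _ =>
  GrpAction.EquivStr.IsEquivariant.whiskerLeft (r.str Λ) (hf Λ)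

theorem EquivStr.whiskerRight_mem {s : A.EquivStr Y} {t : A.EquivStr Z} {f : Y ⟶ Z}
    (hf : f ∈ EquivObj.homs ⟨Y, s⟩ ⟨Z, t⟩) :
    f ▷ X ∈ EquivObj.homs ⟨Y ⊗ X, s.tensor r⟩ ⟨Z ⊗ X, t.tensor r⟩ := fun Λ _ _ =>
  GrpAction.EquivStr.IsEquivariant.whiskerRight (r.str Λ) (hf Λ)

theorem EquivStr.associator_mem :
    (α_ X Y Z).hom ∈ EquivObj.homs ⟨(X ⊗ Y) ⊗ Z, (r.tensor s).tensor t⟩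
      ⟨X ⊗ Y ⊗ Z, r.tensor (s.tensor t)⟩ := fun Λ _ _ =>
  GrpAction.EquivStr.IsEquivariant.associator (r.str Λ) (s.str Λ) (t.str Λ)

theorem EquivStr.leftUnitor_mem :
    (λ_ X).hom ∈ EquivObj.homs ⟨𝟙_ C ⊗ X, EquivStr.unit.tensor r⟩ ⟨X, r⟩ := fun Λ _ _ =>
  GrpAction.EquivStr.IsEquivariant.leftUnitor (r.str Λ)

theorem EquivStr.rightUnitor_mem :
    (ρ_ X).hom ∈ EquivObj.homs ⟨X ⊗ 𝟙_ C, r.tensor EquivStr.unit⟩ ⟨X, r⟩ := fun Λ _ _ =>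
  GrpAction.EquivStr.IsEquivariant.rightUnitor (r.str Λ)

theorem EquivStr.braiding_mem :
    (β_ X Y).hom ∈ EquivObj.homs ⟨X ⊗ Y, r.tensor s⟩ ⟨Y ⊗ X, s.tensor r⟩ := fun Λ _ _ =>
  GrpAction.EquivStr.IsEquivariant.braiding (r.str Λ) (s.str Λ)

end

/-- The tensor product of `C^Q` is that of `C` on objects and morphisms, with `α ⊗ β` as structure
on `X ⊗ Y`; the unit, the associator and the unitors are those of `C`. -/
noncomputable instance : MonoidalCategoryStruct A.EquivObj where
  tensorObj X Y := ⟨X.obj ⊗ Y.obj, X.equivStr.tensor Y.equivStr⟩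
  tensorUnit := ⟨𝟙_ C, EquivStr.unit⟩
  whiskerLeft X _ _ f := ⟨X.obj ◁ f.1, X.equivStr.whiskerLeft_mem f.2⟩
  whiskerRight f X := ⟨f.1 ▷ X.obj, X.equivStr.whiskerRight_mem f.2⟩
  associator X Y Z := EquivObj.mkIso (α_ X.obj Y.obj Z.obj)
    (EquivStr.associator_mem X.equivStr Y.equivStr Z.equivStr)
  leftUnitor X := EquivObj.mkIso (λ_ X.obj) (EquivStr.leftUnitor_mem X.equivStr)
  rightUnitor X := EquivObj.mkIso (ρ_ X.obj) (EquivStr.rightUnitor_mem X.equivStr)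

noncomputable instance : MonoidalCategory A.EquivObj where
  tensorHom_def f g := rfl
  id_tensorHom_id X Y := Subtype.ext
    ((MonoidalCategory.tensorHom_def (𝟙 X.obj) (𝟙 Y.obj)).symm.trans (id_tensorHom_id X.obj Y.obj))
  tensorHom_comp_tensorHom f₁ f₂ g₁ g₂ := Subtype.ext <| by
    have := tensorHom_comp_tensorHom f₁.1 f₂.1 g₁.1 g₂.1
    simp only [MonoidalCategory.tensorHom_def] at this
    exact this
  whiskerLeft_id X Y := Subtype.ext (whiskerLeft_id X.obj Y.obj)
  id_whiskerRight X Y := Subtype.ext (id_whiskerRight X.obj Y.obj)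
  associator_naturality f₁ f₂ f₃ := Subtype.ext <| by
    have := associator_naturality f₁.1 f₂.1 f₃.1
    simp only [MonoidalCategory.tensorHom_def] at this
    exact this
  leftUnitor_naturality f := Subtype.ext (leftUnitor_naturality f.1)
  rightUnitor_naturality f := Subtype.ext (rightUnitor_naturality f.1)
  pentagon W X Y Z := Subtype.ext (pentagon W.obj X.obj Y.obj Z.obj)
  triangle X Y := Subtype.ext (triangle X.obj Y.obj)

/-- The symmetry of `C^Q` is that of `C`. -/
noncomputable instance : SymmetricCategory A.EquivObj where
  braiding X Y := EquivObj.mkIso (β_ X.obj Y.obj)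
    (EquivStr.braiding_mem X.equivStr Y.equivStr)
  braiding_naturality_right X _ _ f :=
    Subtype.ext (BraidedCategory.braiding_naturality_right X.obj f.1)
  braiding_naturality_left f Z :=
    Subtype.ext (BraidedCategory.braiding_naturality_left f.1 Z.obj)
  hexagon_forward X Y Z := Subtype.ext (BraidedCategory.hexagon_forward X.obj Y.obj Z.obj)
  hexagon_reverse X Y Z := Subtype.ext (BraidedCategory.hexagon_reverse X.obj Y.obj Z.obj)
  symmetry X Y := Subtype.ext (SymmetricCategory.symmetry X.obj Y.obj)

instance : MonoidalPreadditive A.EquivObj where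
  whiskerLeft_zero := Subtype.ext MonoidalPreadditive.whiskerLeft_zero
  zero_whiskerRight := Subtype.ext MonoidalPreadditive.zero_whiskerRight
  whiskerLeft_add f g := Subtype.ext (MonoidalPreadditive.whiskerLeft_add f.1 g.1)
  add_whiskerRight f g := Subtype.ext (MonoidalPreadditive.add_whiskerRight f.1 g.1)

instance : MonoidalLinear F A.EquivObj where
  whiskerLeft_smul X _ _ r f := Subtype.ext (MonoidalLinear.whiskerLeft_smul X.obj r f.1)
  smul_whiskerRight r _ _ f X := Subtype.ext (MonoidalLinear.smul_whiskerRight r f.1 X.obj)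

/-- The forgetful functor `C^Q ⥤ C` is strictly monoidal. -/
noncomputable instance : A.forget.Monoidal :=
  Functor.CoreMonoidal.toMonoidal
    { εIso := Iso.refl (𝟙_ C)
      μIso := fun X Y => Iso.refl (X.obj ⊗ Y.obj)
      μIso_hom_natural_left := fun _ _ => (Category.comp_id _).trans (Category.id_comp _).symm
      μIso_hom_natural_right := fun _ _ => (Category.comp_id _).trans (Category.id_comp _).symm
      associativity := fun X Y Z => by
        change 𝟙 (X.obj ⊗ Y.obj) ▷ Z.obj ≫ 𝟙 ((X.obj ⊗ Y.obj) ⊗ Z.obj) ≫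
            (α_ X.obj Y.obj Z.obj).hom =
          (α_ X.obj Y.obj Z.obj).hom ≫ X.obj ◁ 𝟙 (Y.obj ⊗ Z.obj) ≫ 𝟙 (X.obj ⊗ Y.obj ⊗ Z.obj)
        simp
      left_unitality := fun X => by
        change (λ_ X.obj).hom = 𝟙 (𝟙_ C) ▷ X.obj ≫ 𝟙 (𝟙_ C ⊗ X.obj) ≫ (λ_ X.obj).hom
        simp
      right_unitality := fun X => by
        change (ρ_ X.obj).hom = X.obj ◁ 𝟙 (𝟙_ C) ≫ 𝟙 (X.obj ⊗ 𝟙_ C) ≫ (ρ_ X.obj).hom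
        simp }

/-- The forgetful functor `C^Q ⥤ C` is symmetric monoidal. -/
noncomputable instance : A.forget.Braided where
  braided X Y := by
    change 𝟙 (X.obj ⊗ Y.obj) ≫ (β_ X.obj Y.obj).hom = (β_ X.obj Y.obj).hom ≫ 𝟙 (Y.obj ⊗ X.obj)
    simp

end Monoidal

end AlgAction

/-! ## Duals -/

section Duals

open Functor.LaxMonoidal Functor.OplaxMonoidal Functor.Monoidal

/-- The image under a monoidal functor of a pair of dual objects. -/
@[reducible]
def mapExactPairing {C : Type*} [Category* C] [MonoidalCategory C] {D : Type*} [Category* D]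
    [MonoidalCategory D] (R : C ⥤ D) [R.Monoidal] (X Y : C) [ExactPairing X Y] :
    ExactPairing (R.obj X) (R.obj Y) where
  coevaluation' := ε R ≫ R.map (η_ X Y) ≫ δ R X Y
  evaluation' := μ R Y X ≫ R.map (ε_ X Y) ≫ η R
  coevaluation_evaluation' := by
    have h := congrArg R.map (ExactPairing.coevaluation_evaluation X Y)
    simp only [Functor.map_comp, map_whiskerLeft, map_whiskerRight, map_associator_inv,
      map_rightUnitor, map_leftUnitor_inv, Category.assoc, μ_δ_assoc] at h
    rw [cancel_epi] at h
    rw [← cancel_epi (R.obj Y ◁ η R), ← cancel_mono (ε R ▷ R.obj Y),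
      ← cancel_mono (μ R (𝟙_ C) Y)]
    simp only [MonoidalCategory.whiskerLeft_comp, comp_whiskerRight, Category.assoc,
      whiskerLeft_η_ε_assoc, whiskerRight_η_ε_assoc]
    exact h
  evaluation_coevaluation' := by
    have h := congrArg R.map (ExactPairing.evaluation_coevaluation X Y)
    simp only [Functor.map_comp, map_whiskerLeft, map_whiskerRight, map_associator,
      map_leftUnitor, map_rightUnitor_inv, Category.assoc, μ_δ_assoc] at h
    rw [cancel_epi] at h
    rw [← cancel_epi (η R ▷ R.obj X), ← cancel_mono (R.obj X ◁ ε R),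
      ← cancel_mono (μ R X (𝟙_ C))]
    simp only [MonoidalCategory.whiskerLeft_comp, comp_whiskerRight, Category.assoc,
      whiskerLeft_η_ε_assoc, whiskerRight_η_ε_assoc]
    exact h

variable {F H : Type u} [Field F] [CommRing H] [HopfAlgebra F H]
variable {C : Type w} [Category.{v} C] [Preadditive C] [Linear F C] [MonoidalCategory C]
  [MonoidalPreadditive C] [MonoidalLinear F C]

/-- If `Y` is dual to `X` in `C`, then `Y ⊗ Λ` is dual to `X ⊗ Λ` in `C_Λ`. -/
@[reducible]
noncomputable def BaseChange.exactPairing (Λ : Type u) [CommRing Λ] [Algebra F Λ] (X Y : C)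
    [ExactPairing X Y] : ExactPairing (⟨X⟩ : BaseChange F C Λ) (⟨Y⟩ : BaseChange F C Λ) where
  coevaluation' := (BaseChange.incl F C Λ).map (η_ X Y)
  evaluation' := (BaseChange.incl F C Λ).map (ε_ X Y)
  coevaluation_evaluation' := by
    change (_ ◁ tm 1 _) ≫ tm 1 _ ≫ (tm 1 _ ▷ _) = tm 1 _ ≫ tm 1 _
    rw [whiskerLeft_tm, tm_whiskerRight]
    refine ((congrArg _ (tm_comp_tm ..)).trans (tm_comp_tm ..)).trans
      (Eq.trans ?_ (tm_comp_tm ..).symm)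
    rw [mul_one, mul_one]
    exact congrArg (tm _) (ExactPairing.coevaluation_evaluation X Y)
  evaluation_coevaluation' := by
    change (tm 1 _ ▷ _) ≫ tm 1 _ ≫ (_ ◁ tm 1 _) = tm 1 _ ≫ tm 1 _
    rw [whiskerLeft_tm, tm_whiskerRight]
    refine ((congrArg _ (tm_comp_tm ..)).trans (tm_comp_tm ..)).trans
      (Eq.trans ?_ (tm_comp_tm ..).symm)
    rw [mul_one, mul_one]
    exact congrArg (tm _) (ExactPairing.evaluation_coevaluation X Y)

/-- Let `Y` be dual to `X` in `C` (via `ExactPairing X Y`) and `α : q · (X ⊗ Λ) ≅ X ⊗ Λ`. The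
inverse-transpose of `α` is the composite
`q · (Y ⊗ Λ) = q · (X ⊗ Λ)^∨ = (q · (X ⊗ Λ))^∨ ⟶ (X ⊗ Λ)^∨ = Y ⊗ Λ`
whose arrow is the transpose of `α⁻¹`. -/
noncomputable def AlgAction.inverseTranspose [SymmetricCategory C] (A : AlgAction F H C)
    [A.Monoidal] (X Y : C) [ExactPairing X Y] {Λ : Type u} [CommRing Λ] [Algebra F Λ]
    (q : Points F H Λ)
    (α : ((A.action Λ).act q).obj (⟨X⟩ : BaseChange F C Λ) ≅ (⟨X⟩ : BaseChange F C Λ)) :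
    ((A.action Λ).act q).obj (⟨Y⟩ : BaseChange F C Λ) ⟶ (⟨Y⟩ : BaseChange F C Λ) :=
  letI := BaseChange.exactPairing (F := F) Λ X Y
  letI := mapExactPairing ((A.action Λ).act q) (⟨X⟩ : BaseChange F C Λ) (⟨Y⟩ : BaseChange F C Λ)
  letI : HasRightDual (⟨X⟩ : BaseChange F C Λ) := ⟨⟨Y⟩⟩
  letI : HasRightDual (((A.action Λ).act q).obj (⟨X⟩ : BaseChange F C Λ)) :=
    ⟨((A.action Λ).act q).obj ⟨Y⟩⟩
  rightAdjointMate α.inv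

end Duals

/-! ## Neutral Tannakian categories -/

section Tannakian

variable (F : Type u) [Field F] {T : Type w} [Category.{v} T] [Preadditive T] [Linear F T]
  [MonoidalCategory T] [SymmetricCategory T]

/-- A fibre functor: an exact faithful `F`-linear (unitary, symmetric) monoidal functor to the
category of finite-dimensional `F`-vector spaces. -/
structure IsFibreFunctor (ω : T ⥤ FGModuleCat.{u} F) [ω.Braided] : Prop where
  additive : ω.Additive
  linear : ω.Linear F
  faithful : ω.Faithful
  preservesFiniteLimits : Limits.PreservesFiniteLimits ω
  preservesFiniteColimits : Limits.PreservesFiniteColimits ω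

variable (T) [MonoidalPreadditive T] [MonoidalLinear F T]

/-- The symmetric monoidal `F`-linear category `T` (with `F`-bilinear tensor product) is neutral
Tannakian over `F`: it is abelian and rigid, `End(𝟙) = F`, and there is a fibre functor. -/
structure IsNeutralTannakian : Prop where
  hasFiniteProducts : Limits.HasFiniteProducts T
  hasKernels : Limits.HasKernels T
  hasCokernels : Limits.HasCokernels T
  normalMono : IsNormalMonoCategory T
  normalEpi : IsNormalEpiCategory T
  rigid : Nonempty (RigidCategory T)
  end_unit : Function.Bijective fun a : F => a • 𝟙 (𝟙_ T)
  exists_fibreFunctor : ∃ (ω : T ⥤ FGModuleCat.{u} F) (_ : ω.Braided), IsFibreFunctor F ω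

end Tannakian

/-! ## Exactness of extension of scalars -/

/-! Hom-spaces of `C^Q` are subspaces of those of `C`, so the content is that the constructions of
abelian rigid categories carry equivariant structures. Each construction rests on the same
principle: the wanted maps `β_{Λ,q} : q · (X ⊗ Λ) ⟶ X ⊗ Λ` exist and are the only ones satisfying a
certain equation. Uniqueness then gives the unit law, the cocycle law and compatibility with `Λ →
Λ'`. Invertibility is automatic, since a cocycle over a group whose value at `1` is invertible is
invertible everywhere (`isIso_of_cocycle`).

For kernels, cokernels and biproducts the equation is compatibility with the structural maps. A
kernel in `C` remains one in `C_Λ` because the Hom-spaces of `C_Λ` are those of `C` tensored with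
`Λ`, which is flat over the field `F`; cokernels likewise, and `q · -` preserves them because it is
an equivalence. Kernels and cokernels in `C^Q` are therefore computed in `C`. The forgetful functor
is exact, faithful and sends monomorphisms to monomorphisms and epimorphisms to epimorphisms, so
normality is inherited and `ω ∘ for_Q` is a fibre functor.

For a dual `Y` of `X` the equation is `(β ⊗ α) ≫ ev = q · ev`. It is satisfied by the
inverse-transpose of `α` (`mapTranspose_evaluation`) and has no other solution because evaluation is
a perfect pairing (`separatesLeft_evaluation`). Monoidality of the coherence isomorphisms says that
they respect the transported pairings, which is all that the three laws require. -/

namespace BaseChange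

variable {F : Type u} [Field F] {C : Type w} [Category.{v} C] [Preadditive C] [Linear F C]
variable {Λ : Type u} [CommRing Λ] [Algebra F Λ]

variable (F Λ) in
/-- The morphism `1 ⊗ f` of `C_Λ`. -/
noncomputable def inclMap {X Y : C} (f : X ⟶ Y) : (⟨X⟩ : BaseChange F C Λ) ⟶ ⟨Y⟩ := tm 1 f

/-- Every object of `C_Λ` comes from `C`, so composition with `1 ⊗ f` is `Λ ⊗_F -` applied to
composition with `f`. Exactness questions in `C_Λ` thus reduce to flatness of `Λ`. -/
theorem comp_inclMap {W : BaseChange F C Λ} {X Y : C} (l : W ⟶ ⟨X⟩) (f : X ⟶ Y) :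
    l ≫ inclMap F Λ f = (Linear.rightComp F W.obj f).lTensor Λ l := by
  induction l using hom_induction with
  | zero => rw [Limits.zero_comp]; exact (map_zero _).symm
  | tm a g => rw [inclMap, tm_comp_tm, mul_one]; rfl
  | add l l' h h' => rw [Preadditive.add_comp, h, h']; exact (map_add _ _ _).symm

theorem inclMap_comp {W : BaseChange F C Λ} {X Y : C} (f : X ⟶ Y) (l : ⟨Y⟩ ⟶ W) :
    inclMap F Λ f ≫ l = (Linear.leftComp F W.obj f).lTensor Λ l := by
  induction l using hom_induction with
  | zero => rw [Limits.comp_zero]; exact (map_zero _).symm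
  | tm a g => rw [inclMap, tm_comp_tm, one_mul]; rfl
  | add l l' h h' => rw [Preadditive.comp_add, h, h']; exact (map_add _ _ _).symm

/-- Monomorphy is injectivity on Hom-spaces, which tensoring with the flat module `Λ` preserves; the
epimorphism case is the same with the other variable. -/
instance inclMap_mono {X Y : C} (f : X ⟶ Y) [Mono f] :
    Mono (inclMap F Λ f) where
  right_cancellation {W} l l' h := by
    rw [comp_inclMap, comp_inclMap] at h
    exact Module.Flat.lTensor_preserves_injective_linearMap _
      (fun a b hab => (cancel_mono f).1 hab) h

instance inclMap_epi {X Y : C} (f : X ⟶ Y) [Epi f] :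
    Epi (inclMap F Λ f) where
  left_cancellation {W} l l' h := by
    rw [inclMap_comp, inclMap_comp] at h
    exact Module.Flat.lTensor_preserves_injective_linearMap _
      (fun a b hab => (cancel_epi f).1 hab) h

theorem inclMap_id (X : C) : inclMap F Λ (𝟙 X) = 𝟙 _ := rfl

theorem inclMap_inclMap {X Y Z : C} (f : X ⟶ Y) (g : Y ⟶ Z) :
    inclMap F Λ f ≫ inclMap F Λ g = inclMap F Λ (f ≫ g) :=
  ((incl F C Λ).map_comp f g).symm

theorem inclMap_zero (X Y : C) : inclMap F Λ (0 : X ⟶ Y) = 0 := tm_zero _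

theorem inclMap_add {X Y : C} (f g : X ⟶ Y) :
    inclMap F Λ (f + g) = inclMap F Λ f + inclMap F Λ g := tm_add _ _ _

/-- The functor `C ⥤ C_Λ` preserves kernels. -/
theorem exists_comp_inclMap {K X Y : C} {k : K ⟶ X} {f : X ⟶ Y} {w : k ≫ f = 0}
    (hk : Limits.IsLimit (Limits.KernelFork.ofι k w)) {W : BaseChange F C Λ} (g : W ⟶ ⟨X⟩)
    (hg : g ≫ inclMap F Λ f = 0) : ∃ l : W ⟶ ⟨K⟩, l ≫ inclMap F Λ k = g := by
  -- The kernel property, read as exactness of `Hom(W, K) → Hom(W, X) → Hom(W, Y)` in the middle;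
  -- flatness transports it to `C_Λ`.
  have hexact : Function.Exact (Linear.rightComp F W.obj k) (Linear.rightComp F W.obj f) := fun x =>
    ⟨fun hx => ⟨_, (Limits.KernelFork.IsLimit.lift' hk x hx).2⟩, by
      rintro ⟨y, rfl⟩
      simp [w]⟩
  rw [comp_inclMap] at hg
  obtain ⟨l, hl⟩ := (Module.Flat.lTensor_exact Λ hexact g).1 hg
  exact ⟨l, (comp_inclMap _ _).trans hl⟩

/-- The functor `C ⥤ C_Λ` preserves cokernels. -/
noncomputable def isColimitInclMap {X Y Q : C} {f : X ⟶ Y} {p : Y ⟶ Q} {w : f ≫ p = 0}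
    (hp : Limits.IsColimit (Limits.CokernelCofork.ofπ p w)) :
    Limits.IsColimit (Limits.CokernelCofork.ofπ (f := inclMap F Λ f) (inclMap F Λ p)
      (by rw [inclMap_inclMap, w, inclMap_zero])) :=
  haveI : Epi p := Limits.Cofork.IsColimit.epi hp
  Limits.CokernelCofork.IsColimit.ofπ' _ _ fun {W} g hg => by
    have hexact : Function.Exact (Linear.leftComp F W.obj p) (Linear.leftComp F W.obj f) := fun x =>
      ⟨fun hx => ⟨_, (Limits.CokernelCofork.IsColimit.desc' hp x hx).2⟩, by
        rintro ⟨y, rfl⟩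
        simp [reassoc_of% w]⟩
    have hl : ∃ l, inclMap F Λ p ≫ l = g := by
      rw [inclMap_comp] at hg
      obtain ⟨l, hl⟩ := (Module.Flat.lTensor_exact Λ hexact g).1 hg
      exact ⟨l, (inclMap_comp _ _).trans hl⟩
    exact ⟨hl.choose, hl.choose_spec⟩

theorem map_inclMap {Λ' : Type u} [CommRing Λ'] [Algebra F Λ'] (φ : Λ →ₐ[F] Λ') {X Y : C}
    (f : X ⟶ Y) : (map φ).map (inclMap F Λ f) = inclMap F Λ' f := by
  rw [inclMap, map_tm, _root_.map_one]; rfl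

end BaseChange

/-! ## Equivariant structures given by families of morphisms -/

namespace GrpAction

variable {G : Type u} [Group G] {D : Type w} [Category.{v} D] (A : GrpAction G D)

/-- The equivalence `g · -`, with inverse `g⁻¹ · -`. -/
def actEquivalence (g : G) : D ≌ D :=
  CategoryTheory.Equivalence.mk (A.act g) (A.act g⁻¹)
    (A.one.symm ≪≫ eqToIso (congrArg A.act (inv_mul_cancel g).symm) ≪≫ (A.mul g⁻¹ g).symm)
    (A.mul g g⁻¹ ≪≫ eqToIso (congrArg A.act (mul_inv_cancel g)) ≪≫ A.one)

/-- An equivalence preserves epimorphisms and cokernels, which is needed whenever a structure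
descends to a quotient. -/
instance (g : G) : (A.act g).IsEquivalence :=
  inferInstanceAs (actEquivalence A g).functor.IsEquivalence

variable {A}

/-- Morphisms `g · X ⟶ X` satisfying the cocycle condition are automatically isomorphisms. -/
theorem isIso_of_cocycle {X : D} (β : ∀ g : G, (A.act g).obj X ⟶ X)
    (h₁ : β 1 = A.one.hom.app X)
    (hm : ∀ g₂ g₁ : G, (A.mul g₂ g₁).hom.app X ≫ β (g₂ * g₁) = (A.act g₂).map (β g₁) ≫ β g₂)
    (g : G) : IsIso (β g) := by
  have h₁' : IsIso (β 1) := h₁ ▸ inferInstance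
  -- By the cocycle law for `(g, g⁻¹)`, this composite is `β 1` up to a canonical isomorphism. Hence
  -- every `β g` is a split epimorphism and every `g · β_{g⁻¹}` a split monomorphism.
  have key : ∀ g : G, IsIso ((A.act g).map (β g⁻¹) ≫ β g) := fun g => by
    have : IsIso (β (g * g⁻¹)) := by rw [mul_inv_cancel]; exact h₁'
    rw [← hm]; infer_instance
  have hsplit : ∀ g : G, IsSplitEpi (β g) := fun g =>
    ⟨⟨⟨inv ((A.act g).map (β g⁻¹) ≫ β g) ≫ (A.act g).map (β g⁻¹), by
      have := key g
      rw [Category.assoc, IsIso.inv_hom_id]⟩⟩⟩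
  have h₂ : IsSplitMono ((A.act g).map (β g⁻¹)) :=
    ⟨⟨⟨β g ≫ inv ((A.act g).map (β g⁻¹) ≫ β g), by
      have := key g
      rw [← Category.assoc, IsIso.hom_inv_id]⟩⟩⟩
  -- `g · β_{g⁻¹}` is also a split epimorphism, as the image of one; being then invertible, it can
  -- be cancelled from the composite in `key`.
  have := hsplit g⁻¹
  have h₃ : IsIso ((A.act g).map (β g⁻¹)) := isIso_of_mono_of_isSplitEpi _
  have := key g
  exact IsIso.of_isIso_comp_left ((A.act g).map (β g⁻¹)) (β g)

/-- The equivariant structure given by a family of morphisms satisfying the cocycle condition. -/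
noncomputable def EquivStr.ofHom {X : D} (β : ∀ g : G, (A.act g).obj X ⟶ X)
    (h₁ : β 1 = A.one.hom.app X)
    (hm : ∀ g₂ g₁ : G, (A.mul g₂ g₁).hom.app X ≫ β (g₂ * g₁) = (A.act g₂).map (β g₁) ≫ β g₂) :
    A.EquivStr X where
  iso g := haveI := isIso_of_cocycle β h₁ hm g; asIso (β g)
  iso_one := h₁
  iso_mul := hm

/-! ### Structures lifted along a jointly monic family. -/

section Lift

variable {X : D} {ι : Type*} {Y : ι → D} (s : ∀ i, A.EquivStr (Y i)) (p : ∀ i, X ⟶ Y i)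
  (hp : ∀ {W : D} (l l' : W ⟶ X), (∀ i, l ≫ p i = l' ≫ p i) → l = l')
  (β : ∀ g : G, (A.act g).obj X ⟶ X)
  (hβ : ∀ g i, (A.act g).map (p i) ≫ ((s i).iso g).hom = β g ≫ p i)

include hp hβ

/-- The unit and cocycle laws for `β` may be tested after each `p i`, where naturality turns them
into the laws of `Y i`. A family is allowed so that one argument serves kernels (a single map) and
biproducts (all projections). -/
theorem lift_one : β 1 = A.one.hom.app X := hp _ _ fun i => by
  rw [← hβ, (s i).iso_one, A.one.hom.naturality, Functor.id_map]

theorem lift_mul (g₂ g₁ : G) :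
    (A.mul g₂ g₁).hom.app X ≫ β (g₂ * g₁) = (A.act g₂).map (β g₁) ≫ β g₂ := hp _ _ fun i => by
  rw [Category.assoc, Category.assoc, ← hβ, ← hβ, ← Functor.map_comp_assoc, ← hβ,
    ← (A.mul g₂ g₁).hom.naturality_assoc, (s i).iso_mul, Functor.comp_map, Functor.map_comp,
    Category.assoc]

end Lift

/-! ### Structures descended along an epimorphism. -/

section Desc

variable {X Y : D} (s : A.EquivStr Y) (p : Y ⟶ X) [Epi p] (β : ∀ g : G, (A.act g).obj X ⟶ X)
  (hβ : ∀ g, (A.act g).map p ≫ β g = (s.iso g).hom ≫ p)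

include hβ

theorem desc_one : β 1 = A.one.hom.app X := by
  rw [← cancel_epi ((A.act 1).map p), hβ, s.iso_one, A.one.hom.naturality, Functor.id_map]

theorem desc_mul (g₂ g₁ : G) :
    (A.mul g₂ g₁).hom.app X ≫ β (g₂ * g₁) = (A.act g₂).map (β g₁) ≫ β g₂ := by
  -- The twice-translated `p` is still an epimorphism because both functors are equivalences.
  rw [← cancel_epi ((A.act g₂).map ((A.act g₁).map p))]
  have h := (A.mul g₂ g₁).hom.naturality_assoc p (β (g₂ * g₁))
  rw [Functor.comp_map] at h
  rw [h, hβ, ← Category.assoc, s.iso_mul, ← Functor.map_comp_assoc, hβ, Functor.map_comp,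
    Category.assoc, Category.assoc, hβ]

end Desc

end GrpAction

/-! ## Lifting and descending equivariant structures -/

namespace AlgAction

section

variable {D D' : Type*} [Category* D] [Category* D'] {R : D ⥤ D} {M : D ⥤ D'} {R' : D' ⥤ D'}
  (θ : R ⋙ M ≅ M ⋙ R')

/-- Applied with `M` a transition functor and `θ` the isomorphism `base φ q`: a lift is determined
by the `p' i`, so naturality of `θ` forces compatibility of the lifts with change of `Λ`. The maps
`p' i` stand for `1 ⊗ p i` over the new algebra. -/
theorem map_eq_of_lift {X : D} {ι : Type*} {Y : ι → D} (p : ∀ i, X ⟶ Y i)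
    (s : ∀ i, R.obj (Y i) ⟶ Y i) (β : R.obj X ⟶ X) (hβ : ∀ i, R.map (p i) ≫ s i = β ≫ p i)
    (p' : ∀ i, M.obj X ⟶ M.obj (Y i)) (hp' : ∀ i, M.map (p i) = p' i)
    (s' : ∀ i, R'.obj (M.obj (Y i)) ⟶ M.obj (Y i)) (β' : R'.obj (M.obj X) ⟶ M.obj X)
    (hβ' : ∀ i, R'.map (p' i) ≫ s' i = β' ≫ p' i)
    (hs : ∀ i, M.map (s i) = θ.hom.app (Y i) ≫ s' i)
    (hp : ∀ {W : D'} (l l' : W ⟶ M.obj X), (∀ i, l ≫ p' i = l' ≫ p' i) → l = l') :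
    M.map β = θ.hom.app X ≫ β' := hp _ _ fun i => by
  have h := θ.hom.naturality_assoc (p i) (s' i)
  rw [Functor.comp_map, Functor.comp_map, hp'] at h
  rw [Category.assoc, ← hβ', ← h, ← hs, ← hp', ← Functor.map_comp, ← Functor.map_comp, hβ]

theorem map_eq_of_desc {X Y : D} (p : Y ⟶ X) (s : R.obj Y ⟶ Y) (β : R.obj X ⟶ X)
    (hβ : R.map p ≫ β = s ≫ p) (p' : M.obj Y ⟶ M.obj X) (hp' : M.map p = p')
    (s' : R'.obj (M.obj Y) ⟶ M.obj Y) (β' : R'.obj (M.obj X) ⟶ M.obj X)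
    (hβ' : R'.map p' ≫ β' = s' ≫ p') (hs : M.map s = θ.hom.app Y ≫ s') (hp : Epi (R'.map p')) :
    M.map β = θ.hom.app X ≫ β' := by
  have h := θ.hom.naturality p
  rw [Functor.comp_map, Functor.comp_map, hp'] at h
  -- `M` is not assumed to preserve epimorphisms; naturality identifies this map with `R'.map p'` up
  -- to the isomorphism `θ`.
  have : Epi (M.map (R.map p)) := by
    have : Epi (M.map (R.map p) ≫ θ.hom.app X) := h ▸ inferInstance
    have e : M.map (R.map p) = (M.map (R.map p) ≫ θ.hom.app X) ≫ θ.inv.app X := by simp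
    rw [e]
    infer_instance
  rw [← cancel_epi (M.map (R.map p)), reassoc_of% h, hβ', ← Functor.map_comp, hβ, Functor.map_comp,
    hs, hp', Category.assoc]

end

variable {F H : Type u} [Field F] [CommRing H] [HopfAlgebra F H]
variable {C : Type w} [Category.{v} C] [Preadditive C] [Linear F C] {A : AlgAction F H C}

/-- Only existence of each `β` has to be supplied, with no coherence in `q` or `Λ`: joint monicity
over every `Λ` makes the choice unique, so all laws follow. -/
theorem exists_equivStr_lift {X : C} {ι : Type*} (Y : ι → A.EquivObj) (p : ∀ i, X ⟶ (Y i).obj)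
    (hp : ∀ (Λ : Type u) [CommRing Λ] [Algebra F Λ] {W : BaseChange F C Λ}
      (l l' : W ⟶ (⟨X⟩ : BaseChange F C Λ)),
      (∀ i, l ≫ BaseChange.inclMap F Λ (p i) = l' ≫ BaseChange.inclMap F Λ (p i)) → l = l')
    (hβ : ∀ (Λ : Type u) [CommRing Λ] [Algebra F Λ] (q : Points F H Λ),
      ∃ β : ((A.action Λ).act q).obj (⟨X⟩ : BaseChange F C Λ) ⟶ (⟨X⟩ : BaseChange F C Λ),
      ∀ i, ((A.action Λ).act q).map (BaseChange.inclMap F Λ (p i)) ≫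
        (((Y i).equivStr.str Λ).iso q).hom = β ≫ BaseChange.inclMap F Λ (p i)) :
    ∃ t : A.EquivStr X, ∀ i, p i ∈ EquivObj.homs ⟨X, t⟩ (Y i) := by
  choose β hβ using hβ
  refine ⟨⟨fun Λ _ _ => GrpAction.EquivStr.ofHom (β Λ)
    (GrpAction.lift_one (fun i => (Y i).equivStr.str Λ)
      (fun i => BaseChange.inclMap F Λ (p i)) (hp Λ) (β Λ) (hβ Λ))
    (GrpAction.lift_mul (fun i => (Y i).equivStr.str Λ)
      (fun i => BaseChange.inclMap F Λ (p i)) (hp Λ) (β Λ) (hβ Λ)), ?_⟩,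
    fun i Λ _ _ q => hβ Λ q i⟩
  intro Λ Λ' _ _ _ _ φ q
  exact map_eq_of_lift (A.base φ q) (fun i => BaseChange.inclMap F Λ (p i)) _ _ (hβ Λ q)
    (fun i => BaseChange.inclMap F Λ' (p i)) (fun i => BaseChange.map_inclMap φ (p i)) _ _
    (hβ Λ' (Points.map φ q)) (fun i => (Y i).equivStr.base φ q) (hp Λ')

/-- Here uniqueness comes from `p` remaining an epimorphism after extension of scalars and after `q
· -`. -/
theorem exists_equivStr_desc {X : C} (Y : A.EquivObj) (p : Y.obj ⟶ X) [Epi p]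
    (hβ : ∀ (Λ : Type u) [CommRing Λ] [Algebra F Λ] (q : Points F H Λ),
      ∃ β : ((A.action Λ).act q).obj (⟨X⟩ : BaseChange F C Λ) ⟶ (⟨X⟩ : BaseChange F C Λ),
      ((A.action Λ).act q).map (BaseChange.inclMap F Λ p) ≫ β =
        ((Y.equivStr.str Λ).iso q).hom ≫ BaseChange.inclMap F Λ p) :
    ∃ t : A.EquivStr X, p ∈ EquivObj.homs Y ⟨X, t⟩ := by
  choose β hβ using hβ
  refine ⟨⟨fun Λ _ _ => GrpAction.EquivStr.ofHom (β Λ)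
    (GrpAction.desc_one (Y.equivStr.str Λ) (BaseChange.inclMap F Λ p) (β Λ) (hβ Λ))
    (GrpAction.desc_mul (Y.equivStr.str Λ) (BaseChange.inclMap F Λ p) (β Λ) (hβ Λ)), ?_⟩,
    fun Λ _ _ q => hβ Λ q⟩
  intro Λ Λ' _ _ _ _ φ q
  have : Epi (((A.action Λ').act (Points.map φ q)).map (BaseChange.inclMap F Λ' p)) :=
    Functor.map_epi _ _
  exact map_eq_of_desc (A.base φ q) (BaseChange.inclMap F Λ p) _ _ (hβ Λ q)
    (BaseChange.inclMap F Λ' p) (BaseChange.map_inclMap φ p) _ _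
    (hβ Λ' (Points.map φ q)) (Y.equivStr.base φ q) this

end AlgAction

/-! ## Kernels, cokernels and biproducts of equivariant objects -/

namespace AlgAction

open Limits

variable {F H : Type u} [Field F] [CommRing H] [HopfAlgebra F H]
variable {C : Type w} [Category.{v} C] [Preadditive C] [Linear F C] {A : AlgAction F H C}

namespace EquivObj

theorem mem_homs_iff {X Y : A.EquivObj} {f : X.obj ⟶ Y.obj} :
    f ∈ X.homs Y ↔ ∀ (Λ : Type u) [CommRing Λ] [Algebra F Λ] (q : Points F H Λ),
      ((A.action Λ).act q).map (BaseChange.inclMap F Λ f) ≫ ((Y.equivStr.str Λ).iso q).hom =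
        ((X.equivStr.str Λ).iso q).hom ≫ BaseChange.inclMap F Λ f :=
  Iff.rfl

/-- Equivariance of `l` is an equality of maps into `X ⊗ Λ`, so it can be tested after the jointly
monic equivariant maps `p i`. This makes universal morphisms computed in `C` equivariant. -/
theorem mem_homs_of_comp {W X : A.EquivObj} {ι : Type*} {Y : ι → A.EquivObj}
    (p : ∀ i, X ⟶ Y i)
    (hp : ∀ (Λ : Type u) [CommRing Λ] [Algebra F Λ] {W : BaseChange F C Λ}
      (l l' : W ⟶ (⟨X.obj⟩ : BaseChange F C Λ)),
      (∀ i, l ≫ BaseChange.inclMap F Λ (p i).1 = l' ≫ BaseChange.inclMap F Λ (p i).1) → l = l')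
    {l : W.obj ⟶ X.obj} (hl : ∀ i, l ≫ (p i).1 ∈ W.homs (Y i)) : l ∈ W.homs X := by
  rw [mem_homs_iff]
  intro Λ _ _ q
  refine hp Λ _ _ fun i => ?_
  rw [Category.assoc, Category.assoc, ← mem_homs_iff.1 (p i).2, BaseChange.inclMap_inclMap,
    ← mem_homs_iff.1 (hl i), ← Functor.map_comp_assoc, BaseChange.inclMap_inclMap]

theorem mem_homs_of_comp_mono {W X Y : A.EquivObj} (p : X ⟶ Y) [Mono p.1] {l : W.obj ⟶ X.obj}
    (hl : l ≫ p.1 ∈ W.homs Y) : l ∈ W.homs X :=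
  mem_homs_of_comp (fun _ : Unit => p) (fun _ _ _ _ _ _ h => (cancel_mono _).1 (h ())) fun _ => hl

theorem mem_homs_of_epi_comp {W X Y : A.EquivObj} (p : Y ⟶ X) [Epi p.1] {l : X.obj ⟶ W.obj}
    (hl : p.1 ≫ l ∈ Y.homs W) : l ∈ X.homs W := by
  rw [mem_homs_iff]
  intro Λ _ _ q
  have : Epi (((A.action Λ).act q).map (BaseChange.inclMap F Λ p.1)) := Functor.map_epi _ _
  rw [← cancel_epi (((A.action Λ).act q).map (BaseChange.inclMap F Λ p.1)),
    reassoc_of% (mem_homs_iff.1 p.2), BaseChange.inclMap_inclMap, ← mem_homs_iff.1 hl,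
    ← Functor.map_comp_assoc, BaseChange.inclMap_inclMap]

end EquivObj

/-! ### Kernels and cokernels in `C^Q` are computed in `C`. -/

section Kernels

variable {X Y : A.EquivObj} (f : X ⟶ Y)

/-- Since `f` is equivariant, `(q · k) ≫ α_q` is killed by `1 ⊗ f`, hence factors through `1 ⊗ k`,
which is still a kernel over `Λ`. -/
theorem exists_equivStr_kernel {K : C} {k : K ⟶ X.obj} {w : k ≫ f.1 = 0}
    (hk : IsLimit (KernelFork.ofι k w)) : ∃ t : A.EquivStr K, k ∈ EquivObj.homs ⟨K, t⟩ X := by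
  have : Mono k := Fork.IsLimit.mono hk
  obtain ⟨t, ht⟩ := exists_equivStr_lift (X := K) (fun _ : Unit => X) (fun _ => k)
    (fun _ _ _ _ _ _ h => (cancel_mono _).1 (h ())) fun Λ _ _ q => by
      obtain ⟨β, hβ⟩ := BaseChange.exists_comp_inclMap hk
        (((A.action Λ).act q).map (BaseChange.inclMap F Λ k) ≫ ((X.equivStr.str Λ).iso q).hom) (by
          rw [Category.assoc, ← EquivObj.mem_homs_iff.1 f.2, ← Functor.map_comp_assoc,
            BaseChange.inclMap_inclMap, w, BaseChange.inclMap_zero, Functor.map_zero, zero_comp])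
      exact ⟨β, fun _ => hβ.symm⟩
  exact ⟨t, ht ()⟩

theorem exists_equivStr_cokernel {Q : C} {p : Y.obj ⟶ Q} {w : f.1 ≫ p = 0}
    (hp : IsColimit (CokernelCofork.ofπ p w)) :
    ∃ t : A.EquivStr Q, p ∈ EquivObj.homs Y ⟨Q, t⟩ := by
  have : Epi p := Cofork.IsColimit.epi hp
  refine exists_equivStr_desc (X := Q) Y p fun Λ _ _ q => ?_
  -- Unlike for kernels, the sought map starts at `q · (Q ⊗ Λ)`, so the cokernel must survive `q ·
  -- -` as well as extension of scalars.
  have hc := CokernelCofork.mapIsColimit _ (BaseChange.isColimitInclMap (F := F) (Λ := Λ) hp)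
    ((A.action Λ).act q)
  have hz : ((A.action Λ).act q).map (BaseChange.inclMap F Λ f.1) ≫
      ((Y.equivStr.str Λ).iso q).hom ≫ BaseChange.inclMap F Λ p = 0 := by
    rw [reassoc_of% (EquivObj.mem_homs_iff.1 f.2), BaseChange.inclMap_inclMap, w,
      BaseChange.inclMap_zero, comp_zero]
  exact ⟨_, (CokernelCofork.IsColimit.desc' hc _ hz).2⟩

/-- A morphism of `C^Q` that is a kernel in `C` is a kernel in `C^Q`. -/
noncomputable def isLimitOfForget {K : A.EquivObj} {k : K ⟶ X} {w : k.1 ≫ f.1 = 0}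
    (hk : IsLimit (KernelFork.ofι k.1 w)) :
    IsLimit (KernelFork.ofι (f := f) k (Subtype.ext w)) :=
  haveI : Mono k.1 := Fork.IsLimit.mono hk
  haveI : Mono k := A.forget.mono_of_mono_map ‹_›
  KernelFork.IsLimit.ofι' _ _ fun {W} g hg =>
    let l := KernelFork.IsLimit.lift' hk g.1 (congrArg Subtype.val hg)
    ⟨⟨l.1, EquivObj.mem_homs_of_comp_mono k ((congrArg (· ∈ EquivObj.homs W _) l.2).mpr g.2)⟩, Subtype.ext l.2⟩

/-- A morphism of `C^Q` that is a cokernel in `C` is a cokernel in `C^Q`. -/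
noncomputable def isColimitOfForget {Q : A.EquivObj} {p : Y ⟶ Q} {w : f.1 ≫ p.1 = 0}
    (hp : IsColimit (CokernelCofork.ofπ p.1 w)) :
    IsColimit (CokernelCofork.ofπ (f := f) p (Subtype.ext w)) :=
  haveI : Epi p.1 := Cofork.IsColimit.epi hp
  haveI : Epi p := A.forget.epi_of_epi_map ‹_›
  CokernelCofork.IsColimit.ofπ' _ _ fun {W} g hg =>
    let l := CokernelCofork.IsColimit.desc' hp g.1 (congrArg Subtype.val hg)
    ⟨⟨l.1, EquivObj.mem_homs_of_epi_comp p ((congrArg (· ∈ EquivObj.homs _ W) l.2).mpr g.2)⟩, Subtype.ext l.2⟩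

theorem exists_kernel [HasKernels C] : ∃ (K : A.EquivObj) (k : K ⟶ X) (w : k.1 ≫ f.1 = 0),
    Nonempty (IsLimit (KernelFork.ofι k.1 w)) := by
  obtain ⟨t, ht⟩ := exists_equivStr_kernel f (w := kernel.condition f.1) (kernelIsKernel f.1)
  exact ⟨⟨_, t⟩, ⟨_, ht⟩, kernel.condition f.1, ⟨kernelIsKernel f.1⟩⟩

theorem exists_cokernel [HasCokernels C] : ∃ (Q : A.EquivObj) (p : Y ⟶ Q) (w : f.1 ≫ p.1 = 0),
    Nonempty (IsColimit (CokernelCofork.ofπ p.1 w)) := by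
  obtain ⟨t, ht⟩ := exists_equivStr_cokernel f (w := cokernel.condition f.1) (cokernelIsCokernel f.1)
  exact ⟨⟨_, t⟩, ⟨_, ht⟩, cokernel.condition f.1, ⟨cokernelIsCokernel f.1⟩⟩

instance [HasKernels C] : HasKernels A.EquivObj where
  has_limit f := by
    obtain ⟨K, k, w, ⟨hk⟩⟩ := exists_kernel f
    exact ⟨⟨_, isLimitOfForget f hk⟩⟩

instance [HasCokernels C] : HasCokernels A.EquivObj where
  has_colimit f := by
    obtain ⟨Q, p, w, ⟨hp⟩⟩ := exists_cokernel f
    exact ⟨⟨_, isColimitOfForget f hp⟩⟩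

instance [HasKernels C] : PreservesLimit (parallelPair f 0) A.forget := by
  obtain ⟨K, k, w, ⟨hk⟩⟩ := exists_kernel f
  exact preservesLimit_of_preserves_limit_cone (isLimitOfForget f hk)
    ((KernelFork.isLimitMapConeEquiv _ A.forget).symm hk)

instance [HasCokernels C] : PreservesColimit (parallelPair f 0) A.forget := by
  obtain ⟨Q, p, w, ⟨hp⟩⟩ := exists_cokernel f
  exact preservesColimit_of_preserves_colimit_cocone (isColimitOfForget f hp)
    ((CokernelCofork.isColimitMapCoconeEquiv _ A.forget).symm hp)

/-- The kernel of `f` formed in `C` carries an equivariant structure, so its inclusion is a morphism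
of `C^Q` killed by `f`. It vanishes when `f` is a monomorphism of `C^Q`, and then `f` has zero
kernel in `C`. -/
instance [HasKernels C] : A.forget.PreservesMonomorphisms where
  preserves f hf := by
    obtain ⟨K, k, w, ⟨hk⟩⟩ := exists_kernel f
    have hz : k = 0 := (cancel_mono f).1 (Subtype.ext (by rw [zero_comp]; exact w))
    refine Preadditive.mono_of_cancel_zero _ fun g hg => ?_
    obtain ⟨l, hl⟩ := KernelFork.IsLimit.lift' hk g hg
    exact hl.symm.trans ((congrArg (fun j : K ⟶ _ => l ≫ j.1) hz).trans comp_zero)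

instance [HasCokernels C] : A.forget.PreservesEpimorphisms where
  preserves f hf := by
    obtain ⟨Q, p, w, ⟨hp⟩⟩ := exists_cokernel f
    have hz : p = 0 := (cancel_epi f).1 (Subtype.ext (by rw [comp_zero]; exact w))
    refine Preadditive.epi_of_cancel_zero _ fun g hg => ?_
    obtain ⟨l, hl⟩ := CokernelCofork.IsColimit.desc' hp g hg
    exact hl.symm.trans ((congrArg (fun j : _ ⟶ Q => j.1 ≫ l) hz).trans zero_comp)

end Kernels

/-! ### Finite biproducts. -/

section Biproducts

open BaseChange in
theorem exists_biproduct [HasFiniteBiproducts C] {n : ℕ} (X : Fin n → A.EquivObj) :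
    ∃ b : Bicone X, ∑ j, b.π j ≫ b.ι j = 𝟙 b.pt := by
  classical
  let Y : Fin n → C := fun i => (X i).obj
  have htot : ∀ (Λ : Type u) [CommRing Λ] [Algebra F Λ],
      ∑ i, inclMap F Λ (biproduct.π Y i) ≫ inclMap F Λ (biproduct.ι Y i) = 𝟙 _ := by
    intro Λ _ _
    simp only [inclMap_inclMap]
    rw [← inclMap_id, ← biproduct.total]
    exact (map_sum (AddMonoidHom.mk' (inclMap F Λ) inclMap_add) _ _).symm
  have hp : ∀ (Λ : Type u) [CommRing Λ] [Algebra F Λ] {W : BaseChange F C Λ}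
      (l l' : W ⟶ (⟨⨁ Y⟩ : BaseChange F C Λ)),
      (∀ i, l ≫ inclMap F Λ (biproduct.π Y i) = l' ≫ inclMap F Λ (biproduct.π Y i)) →
        l = l' := by
    intro Λ _ _ W l l' h
    rw [← Category.comp_id l, ← Category.comp_id l', ← htot Λ, Preadditive.comp_sum,
      Preadditive.comp_sum]
    simp only [← Category.assoc, h]
  obtain ⟨t, ht⟩ := exists_equivStr_lift X (fun i => biproduct.π Y i) hp fun Λ _ _ q =>
    -- The diagonal structure: project, act on each factor, include.
    ⟨∑ i, ((A.action Λ).act q).map (inclMap F Λ (biproduct.π Y i)) ≫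
      (((X i).equivStr.str Λ).iso q).hom ≫ inclMap F Λ (biproduct.ι Y i), fun i => by
      rw [Preadditive.sum_comp, Finset.sum_eq_single i]
      · rw [Category.assoc, Category.assoc, inclMap_inclMap, biproduct.ι_π_self, inclMap_id,
          Category.comp_id]
      · intro j _ hj
        rw [Category.assoc, Category.assoc, inclMap_inclMap, biproduct.ι_π_ne _ hj, inclMap_zero,
          comp_zero, comp_zero]
      · simp⟩
  let Z : A.EquivObj := ⟨⨁ Y, t⟩
  let p : ∀ i, Z ⟶ X i := fun i => ⟨biproduct.π Y i, ht i⟩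
  refine ⟨{ pt := Z, π := p, ι := fun i => ⟨biproduct.ι Y i, ?_⟩, ι_π := fun i j => ?_ }, ?_⟩
  -- Tested against the projections, an inclusion becomes an identity or zero, both equivariant.
  · refine EquivObj.mem_homs_of_comp p hp fun j => ?_
    change biproduct.ι Y i ≫ biproduct.π Y j ∈ _
    rw [biproduct.ι_π]
    split_ifs with h
    · subst h
      exact (𝟙 (X i) : X i ⟶ X i).2
    · exact zero_mem _
  · refine Subtype.ext ((biproduct.ι_π Y i j).trans ?_)
    split_ifs with h
    · subst h
      rfl
    · rfl
  · apply A.forget.map_injective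
    rw [Functor.map_sum]
    exact biproduct.total

instance [HasFiniteBiproducts C] : HasFiniteBiproducts A.EquivObj where
  out n := ⟨fun X => by
    obtain ⟨b, hb⟩ := exists_biproduct X
    exact hasBiproduct_of_total b hb⟩

end Biproducts

end AlgAction

/-! ### Normality, and exactness of the forgetful functor. -/

section Abelian

open Limits

variable {F H : Type u} [Field F] [CommRing H] [HopfAlgebra F H]
variable {C : Type w} [Category.{v} C] [Abelian C] [Linear F C] {A : AlgAction F H C}

instance : HasFiniteBiproducts A.EquivObj :=
  haveI : HasFiniteBiproducts C := Abelian.hasFiniteBiproducts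
  inferInstance

/-- A monomorphism of `C^Q` is one in `C`, hence there the kernel of its cokernel. That cokernel
underlies a morphism of `C^Q`, and being a kernel in `C` implies being one in `C^Q`. -/
instance : IsNormalMonoCategory A.EquivObj where
  normalMonoOfMono f _ := by
    obtain ⟨Q, p, w, ⟨hp⟩⟩ := AlgAction.exists_cokernel f
    have : Mono f.1 := inferInstanceAs (Mono (A.forget.map f))
    have hf : IsLimit (KernelFork.ofι f.1 w) := Abelian.monoIsKernelOfCokernel _ hp
    exact ⟨⟨Q, p, Subtype.ext w, AlgAction.isLimitOfForget p hf⟩⟩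

instance : IsNormalEpiCategory A.EquivObj where
  normalEpiOfEpi f _ := by
    obtain ⟨K, k, w, ⟨hk⟩⟩ := AlgAction.exists_kernel f
    have : Epi f.1 := inferInstanceAs (Epi (A.forget.map f))
    have hf : IsColimit (CokernelCofork.ofπ f.1 w) := Abelian.epiIsCokernelOfKernel _ hk
    exact ⟨⟨K, k, Subtype.ext w, AlgAction.isColimitOfForget k hf⟩⟩

instance : PreservesFiniteLimits A.forget :=
  haveI : HasBinaryBiproducts A.EquivObj := hasBinaryBiproducts_of_finite_biproducts _
  haveI : HasEqualizers A.EquivObj := Preadditive.hasEqualizers_of_hasKernels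
  Functor.preservesFiniteLimits_of_preservesKernels _

instance : PreservesFiniteColimits A.forget :=
  haveI : HasBinaryBiproducts A.EquivObj := hasBinaryBiproducts_of_finite_biproducts _
  haveI : HasCoequalizers A.EquivObj := Preadditive.hasCoequalizers_of_hasCokernels
  Functor.preservesFiniteColimits_of_preservesCokernels _

end Abelian

/-! ## Duals of equivariant objects -/

section Transpose

open Functor.LaxMonoidal Functor.OplaxMonoidal Functor.Monoidal

variable {D : Type*} [Category* D] [MonoidalCategory D] {D' : Type*} [Category* D']
  [MonoidalCategory D'] {D'' : Type*} [Category* D''] [MonoidalCategory D'']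

/-- The image of a pairing `Y ⊗ X ⟶ 𝟙` under a monoidal functor. -/
def mapPairing (R : D ⥤ D') [R.Monoidal] {X Y : D} (e : Y ⊗ X ⟶ 𝟙_ D) :
    R.obj Y ⊗ R.obj X ⟶ 𝟙_ D' :=
  μ R Y X ≫ R.map e ≫ η R

theorem mapPairing_id {X Y : D} (e : Y ⊗ X ⟶ 𝟙_ D) : mapPairing (𝟭 D) e = e := by
  simp [mapPairing]

theorem mapPairing_comp (R : D ⥤ D') [R.Monoidal] (S : D' ⥤ D'') [S.Monoidal] {X Y : D}
    (e : Y ⊗ X ⟶ 𝟙_ D) : mapPairing (R ⋙ S) e = mapPairing S (mapPairing R e) := by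
  simp [mapPairing]

theorem mapPairing_tensorHom (R : D ⥤ D') [R.Monoidal] {X Y X' Y' : D} (b : Y' ⟶ Y) (a : X' ⟶ X)
    (e : Y ⊗ X ⟶ 𝟙_ D) :
    (R.map b ⊗ₘ R.map a) ≫ mapPairing R e = mapPairing R ((b ⊗ₘ a) ≫ e) := by
  simp [mapPairing]

/-- Monoidality of `θ` moves it past `μ` and the unit, naturality past `e`. It is used for all three
coherence isomorphisms of an algebraic action: unit, multiplication and base change. -/
theorem tensorHom_app_mapPairing {R R' : D ⥤ D'} [R.Monoidal] [R'.Monoidal] (θ : R ⟶ R')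
    [NatTrans.IsMonoidal θ] {X Y : D} (e : Y ⊗ X ⟶ 𝟙_ D) :
    (θ.app Y ⊗ₘ θ.app X) ≫ mapPairing R' e = mapPairing R e := by
  have h₁ := NatTrans.IsMonoidal.tensor (τ := θ) Y X
  have h₂ : θ.app (𝟙_ D) ≫ η R' = η R := by
    rw [← cancel_epi (ε R), ← Category.assoc, NatTrans.IsMonoidal.unit, ε_η, ε_η]
  rw [mapPairing, mapPairing, ← reassoc_of% h₁, ← θ.naturality_assoc, h₂]

/-- A pairing `Y ⊗ X ⟶ 𝟙` for which a morphism to `Y` is determined by its transpose. -/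
def SeparatesLeft {X Y : D} (e : Y ⊗ X ⟶ 𝟙_ D) : Prop :=
  ∀ ⦃Z : D⦄ ⦃b b' : Z ⟶ Y⦄, b ▷ X ≫ e = b' ▷ X ≫ e → b = b'

/-- Duality gives a bijection between maps `Z ⟶ Y` and maps `Z ⊗ X ⟶ 𝟙`, namely pairing with the
evaluation. -/
theorem separatesLeft_evaluation (X Y : D) [ExactPairing X Y] : SeparatesLeft (ε_ X Y) := by
  intro Z b b' h
  let : HasRightDual X := ⟨Y⟩
  have h' := congrArg (tensorRightHomEquiv Z X Y (𝟙_ D)) h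
  have key : ∀ c : Z ⟶ Y,
      (tensorRightHomEquiv Z X Y (𝟙_ D)) (c ▷ X ≫ ε_ X Y) = c ≫ (λ_ _).inv :=
    fun c => tensorRightHomEquiv_whiskerRight_comp_evaluation (X := X) c
  rw [key, key] at h'
  exact (cancel_mono _).1 h'

theorem SeparatesLeft.eq_of_tensorHom {X Y X' Y' : D} {e : Y ⊗ X ⟶ 𝟙_ D} (he : SeparatesLeft e)
    {b b' : Y' ⟶ Y} {a : X' ⟶ X} [IsIso a] (h : (b ⊗ₘ a) ≫ e = (b' ⊗ₘ a) ≫ e) : b = b' := by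
  refine he ?_
  rw [tensorHom_def', tensorHom_def', Category.assoc, Category.assoc, cancel_epi] at h
  exact h

/-- The transpose of `α⁻¹`, for an isomorphism `α : R X ≅ X`. -/
def mapTranspose (R : D ⥤ D) [R.Monoidal] (X Y : D) [ExactPairing X Y] (α : R.obj X ≅ X) :
    R.obj Y ⟶ Y :=
  letI := mapExactPairing R X Y
  letI : HasRightDual X := ⟨Y⟩
  letI : HasRightDual (R.obj X) := ⟨R.obj Y⟩
  rightAdjointMate α.inv

/-- The defining equation of the inverse-transpose: together with separation it determines the map,
and the laws of the dual structure are deduced from it alone. -/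
theorem mapTranspose_evaluation (R : D ⥤ D) [R.Monoidal] (X Y : D) [ExactPairing X Y]
    (α : R.obj X ≅ X) :
    (mapTranspose R X Y α ⊗ₘ α.hom) ≫ ε_ X Y = mapPairing R (ε_ X Y) := by
  let := mapExactPairing R X Y
  let : HasRightDual X := ⟨Y⟩
  let : HasRightDual (R.obj X) := ⟨R.obj Y⟩
  have h : mapTranspose R X Y α ▷ X ≫ ε_ X Y = R.obj Y ◁ α.inv ≫ mapPairing R (ε_ X Y) :=
    rightAdjointMate_comp_evaluation α.inv
  rw [tensorHom_def', Category.assoc, h, whiskerLeft_hom_inv_assoc]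

theorem mapTranspose_coevaluation (R : D ⥤ D) [R.Monoidal] (X Y : D) [ExactPairing X Y]
    (α : R.obj X ≅ X) :
    (ε R ≫ R.map (η_ X Y) ≫ δ R X Y) ≫ (α.hom ⊗ₘ mapTranspose R X Y α) = η_ X Y := by
  let := mapExactPairing R X Y
  let : HasRightDual X := ⟨Y⟩
  let : HasRightDual (R.obj X) := ⟨R.obj Y⟩
  have h : (ε R ≫ R.map (η_ X Y) ≫ δ R X Y) ≫ R.obj X ◁ mapTranspose R X Y α =
      η_ X Y ≫ α.inv ▷ Y :=
    coevaluation_comp_rightAdjointMate α.inv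
  rw [tensorHom_def', ← Category.assoc, h, Category.assoc, inv_hom_whiskerRight, Category.comp_id]

/-- Compatibility of transposes with a monoidal natural isomorphism `R ⋙ M ≅ M ⋙ R'`. -/
theorem map_eq_of_pairing {R : D ⥤ D} {M : D ⥤ D'} {R' : D' ⥤ D'} [R.Monoidal] [M.Monoidal]
    [R'.Monoidal] (θ : R ⋙ M ⟶ M ⋙ R') [NatTrans.IsMonoidal θ] {X Y : D} {e : Y ⊗ X ⟶ 𝟙_ D}
    {a : R.obj X ⟶ X} [IsIso a] {b : R.obj Y ⟶ Y} (hb : (b ⊗ₘ a) ≫ e = mapPairing R e)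
    {e' : M.obj Y ⊗ M.obj X ⟶ 𝟙_ D'} (he' : SeparatesLeft e') (he : mapPairing M e = e')
    {a' : R'.obj (M.obj X) ⟶ M.obj X} {b' : R'.obj (M.obj Y) ⟶ M.obj Y}
    (hb' : (b' ⊗ₘ a') ≫ e' = mapPairing R' e') (ha : M.map a = θ.app X ≫ a') :
    M.map b = θ.app Y ≫ b' := by
  -- Paired with `M.map a`, both sides give the pairing transported along `R ⋙ M`: the left
  -- directly, the right through `M ⋙ R'` and `θ`.
  refine he'.eq_of_tensorHom (a := M.map a) ?_
  rw [← he, mapPairing_tensorHom, hb, ← mapPairing_comp, he, ha, ← tensorHom_comp_tensorHom,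
    Category.assoc, hb', ← he, ← mapPairing_comp]
  exact (tensorHom_app_mapPairing θ e).symm

end Transpose

/-! ### Duals for an action of an abstract group. -/

namespace GrpAction

open Functor.LaxMonoidal Functor.OplaxMonoidal Functor.Monoidal

variable {G : Type u} [Group G] {D : Type w} [Category.{v} D] [MonoidalCategory D]
  [BraidedCategory D] {A : GrpAction G D} [A.Monoidal]

/-- The equivariant structure on the dual of an equivariant object. -/
noncomputable def EquivStr.dual {X : D} (s : A.EquivStr X) (Y : D) [ExactPairing X Y] :
    A.EquivStr Y :=
  EquivStr.ofHom (fun g => mapTranspose (A.act g) X Y (s.iso g))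
    ((separatesLeft_evaluation X Y).eq_of_tensorHom (a := (s.iso 1).hom) (by
      rw [mapTranspose_evaluation, s.iso_one, ← tensorHom_app_mapPairing A.one.hom,
        mapPairing_id]))
    -- By the cocycle law of `s`, the auxiliary isomorphism is also the coherence map followed by
    -- `α_{g₂ g₁}`. Pairing either side with it yields `g₂ · (g₁ · ev)`.
    fun g₂ g₁ => (separatesLeft_evaluation X Y).eq_of_tensorHom
      (a := (A.act g₂).map (s.iso g₁).hom ≫ (s.iso g₂).hom) (by
        refine Eq.trans ?_ (Eq.trans (tensorHom_app_mapPairing (A.mul g₂ g₁).hom (ε_ X Y)) ?_)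
        · rw [← s.iso_mul, ← tensorHom_comp_tensorHom, Category.assoc, mapTranspose_evaluation]
        · rw [← tensorHom_comp_tensorHom, Category.assoc, mapTranspose_evaluation,
            mapPairing_tensorHom, mapTranspose_evaluation, mapPairing_comp])

theorem EquivStr.dual_iso_hom {X : D} (s : A.EquivStr X) (Y : D) [ExactPairing X Y] (g : G) :
    ((s.dual Y).iso g).hom = mapTranspose (A.act g) X Y (s.iso g) := rfl

/-- After cancelling `μ`, equivariance of the evaluation is exactly the defining equation of the
inverse-transpose. -/
theorem EquivStr.isEquivariant_evaluation {X : D} (s : A.EquivStr X) (Y : D) [ExactPairing X Y] :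
    ((s.dual Y).tensor s).IsEquivariant EquivStr.unit (ε_ X Y) := fun g => by
  rw [← cancel_epi (μ (A.act g) Y X), ← Category.assoc (μ _ _ _) ((tensor _ _).iso g).hom,
    μ_tensor, dual_iso_hom, mapTranspose_evaluation]
  rfl

theorem EquivStr.isEquivariant_coevaluation {X : D} (s : A.EquivStr X) (Y : D)
    [ExactPairing X Y] :
    EquivStr.unit.IsEquivariant (s.tensor (s.dual Y)) (η_ X Y) := fun g => by
  rw [← cancel_epi (ε (A.act g)), ← Category.assoc (ε _) (unit.iso g).hom, ε_unit,
    Category.id_comp]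
  have h := mapTranspose_coevaluation (A.act g) X Y (s.iso g)
  rw [Category.assoc, Category.assoc] at h
  exact h

end GrpAction

/-! ### Duals for an algebraic action. -/

namespace AlgAction

variable {F H : Type u} [Field F] [CommRing H] [HopfAlgebra F H]
variable {C : Type w} [Category.{v} C] [Preadditive C] [Linear F C] [MonoidalCategory C]
  [SymmetricCategory C] [MonoidalPreadditive C] [MonoidalLinear F C] {A : AlgAction F H C}
  [A.Monoidal]

/-- The `F`-algebraic equivariant structure on the dual of an equivariant object. -/
noncomputable def EquivStr.dual {X : C} (s : A.EquivStr X) (Y : C) [ExactPairing X Y] :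
    A.EquivStr Y where
  str Λ _ _ :=
    letI := BaseChange.exactPairing (F := F) Λ X Y
    (s.str Λ).dual (⟨Y⟩ : BaseChange F C Λ)
  base {Λ Λ'} _ _ _ _ φ q := by
    let := BaseChange.exactPairing (F := F) Λ X Y
    let := BaseChange.exactPairing (F := F) Λ' X Y
    refine map_eq_of_pairing (A.base φ q).hom (X := (⟨X⟩ : BaseChange F C Λ))
      (Y := (⟨Y⟩ : BaseChange F C Λ))
      (mapTranspose_evaluation ((A.action Λ).act q) (⟨X⟩ : BaseChange F C Λ) ⟨Y⟩
        ((s.str Λ).iso q))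
      (separatesLeft_evaluation (⟨X⟩ : BaseChange F C Λ') ⟨Y⟩) ?_
      (mapTranspose_evaluation ((A.action Λ').act (Points.map φ q)) (⟨X⟩ : BaseChange F C Λ') ⟨Y⟩
        ((s.str Λ').iso (Points.map φ q)))
      (s.base φ q)
    -- The transition functor is strictly monoidal, so the transported evaluation over `Λ` is its
    -- plain image, namely the evaluation over `Λ'`.
    change 𝟙 _ ≫ (BaseChange.map φ).map (BaseChange.inclMap F Λ (ε_ X Y)) ≫ 𝟙 _ =
      BaseChange.inclMap F Λ' (ε_ X Y)
    rw [BaseChange.map_inclMap]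
    exact (Category.id_comp _).trans (Category.comp_id _)

theorem EquivStr.dual_iso_hom {X : C} (s : A.EquivStr X) (Y : C) [ExactPairing X Y] (Λ : Type u)
    [CommRing Λ] [Algebra F Λ] (q : Points F H Λ) :
    (((s.dual Y).str Λ).iso q).hom = A.inverseTranspose X Y q ((s.str Λ).iso q) := rfl

/-- The dual in `C^Q` of an equivariant object, with the evaluation and coevaluation of `C`. -/
@[reducible]
noncomputable def EquivObj.exactPairing (X : A.EquivObj) (Y : C) [ExactPairing X.obj Y] :
    ExactPairing X (⟨Y, X.equivStr.dual Y⟩ : A.EquivObj) where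
  coevaluation' := ⟨η_ X.obj Y, fun Λ _ _ =>
    letI := BaseChange.exactPairing (F := F) Λ X.obj Y
    (X.equivStr.str Λ).isEquivariant_coevaluation (⟨Y⟩ : BaseChange F C Λ)⟩
  evaluation' := ⟨ε_ X.obj Y, fun Λ _ _ =>
    letI := BaseChange.exactPairing (F := F) Λ X.obj Y
    (X.equivStr.str Λ).isEquivariant_evaluation (⟨Y⟩ : BaseChange F C Λ)⟩
  coevaluation_evaluation' := Subtype.ext (ExactPairing.coevaluation_evaluation X.obj Y)
  evaluation_coevaluation' := Subtype.ext (ExactPairing.evaluation_coevaluation X.obj Y)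

end AlgAction

/-! ## The Tannakian category of equivariant objects -/

/-- Endomorphisms of the unit of `C^Q` form a subspace of those of the unit of `C`, and it contains
all scalars. -/
theorem bijective_smul_id_unit_equivObj {F H : Type u} [Field F] [CommRing H] [HopfAlgebra F H]
    {C : Type w} [Category.{v} C] [Preadditive C] [Linear F C] [MonoidalCategory C]
    [SymmetricCategory C] [MonoidalPreadditive C] [MonoidalLinear F C] (A : AlgAction F H C)
    [A.Monoidal] (h : Function.Bijective fun a : F => a • 𝟙 (𝟙_ C)) :
    Function.Bijective fun a : F => a • 𝟙 (𝟙_ A.EquivObj) := by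
  refine ⟨fun a b hab => h.1 (congrArg Subtype.val hab), fun f => ?_⟩
  obtain ⟨a, ha⟩ := h.2 f.1
  exact ⟨a, Subtype.ext ha⟩

/-- A category satisfying `IsNeutralTannakian` is abelian. -/
@[reducible]
noncomputable def IsNeutralTannakian.abelian {F : Type u} [Field F] {T : Type w} [Category.{v} T]
    [P : Preadditive T] [Linear F T] [MonoidalCategory T] [SymmetricCategory T]
    [MonoidalPreadditive T] [MonoidalLinear F T] (hT : IsNeutralTannakian F T) : Abelian T :=
  { P, hT.normalMono, hT.normalEpi with
    has_finite_products := hT.hasFiniteProducts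
    has_kernels := hT.hasKernels
    has_cokernels := hT.hasCokernels }

theorem mainTheorem2 {F : Type u} [Field F] [CharZero F]
    {T : Type w} [Category.{v} T] [Preadditive T] [Linear F T] [MonoidalCategory T]
    [SymmetricCategory T] [MonoidalPreadditive T] [MonoidalLinear F T]
    (hT : IsNeutralTannakian F T)
    {H : Type u} [CommRing H] [HopfAlgebra F H] (A : AlgAction F H T) [A.Monoidal] :
    IsNeutralTannakian F A.EquivObj ∧
    (∀ (X : A.EquivObj) (Y : T) [ExactPairing X.obj Y],
      ∃ (t : A.EquivStr Y) (P : ExactPairing X ⟨Y, t⟩),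
        (∀ (Λ : Type u) [CommRing Λ] [Algebra F Λ] (q : Points F H Λ),
          ((t.str Λ).iso q).hom =
            A.inverseTranspose X.obj Y q ((X.equivStr.str Λ).iso q)) ∧
        A.forget.map P.evaluation = ε_ X.obj Y ∧
        A.forget.map P.coevaluation = η_ X.obj Y) ∧
    (∀ (ω : T ⥤ FGModuleCat.{u} F) [ω.Braided], IsFibreFunctor F ω →
      IsFibreFunctor F (A.forget ⋙ ω)) := by
  let := hT.abelian
  have hω : ∀ (ω : T ⥤ FGModuleCat.{u} F) [ω.Braided], IsFibreFunctor F ω →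
      IsFibreFunctor F (A.forget ⋙ ω) := fun ω _ h =>
    have := h.additive
    have := h.linear
    have := h.faithful
    have := h.preservesFiniteLimits
    have := h.preservesFiniteColimits
    { additive := inferInstance
      linear := inferInstance
      faithful := inferInstance
      preservesFiniteLimits := Limits.comp_preservesFiniteLimits _ _
      preservesFiniteColimits := Limits.comp_preservesFiniteColimits _ _ }
  obtain ⟨rigid⟩ := hT.rigid
  obtain ⟨ω, _, h⟩ := hT.exists_fibreFunctor
  refine ⟨⟨inferInstance, inferInstance, inferInstance,
    inferInstance, inferInstance, ?_, bijective_smul_id_unit_equivObj A hT.end_unit,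
    A.forget ⋙ ω, inferInstance, hω ω h⟩, ?_, hω⟩
  -- Duals chosen in `T` give right duals in `T^Q`; the symmetry supplies the left ones.
  · let : RightRigidCategory A.EquivObj :=
      { rightDual := fun X => { rightDual := _, exact := X.exactPairing (X.obj)ᘁ } }
    exact ⟨BraidedCategory.rigidCategoryOfRightRigidCategory⟩
  · intro X Y _
    exact ⟨X.equivStr.dual Y, X.exactPairing Y, fun Λ _ _ q => X.equivStr.dual_iso_hom Y Λ q,
      rfl, rfl⟩
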